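/- Let $p>3$ be a prime. For $r\ge 1$ and $k\ge 1$ put $O_k^{(r)}=\sum_{j=1}^{k}\frac{1}{(2j-1)^r}$ and $O_k=O_k^{(1)}$. Let $E_n$ denote the Euler numbers, given by $\frac{1}{\cosh t}=\sum_{n\ge 0}E_n\frac{t^n}{n!}$, and let $\Gamma_p:\mathbb{Z}_p\to\mathbb{Z}_p$ be Morita's $p$-adic Gamma function, i.e. the unique continuous function on $\mathbb{Z}_p$ with $\Gamma_p(n)=(-1)^n\prod_{0\le k<n,\ (k,p)=1}k$ for all integers $n\geq 0$. For $x,y\in\mathbb{Q}_p$ write $x\equiv y\pmod{p^m}$ if $x-y\in p^m\mathbb{Z}_p$. Then $$\sum_{k=1}^{p-1}\binom{2k}{k}^3\frac{O_k}{64^k}\equiv\begin{cases}0 \pmod{p^2}&\text{if } p\equiv 1\pmod 4,\\[1mm] -\dfrac{p}{12}\,\Gamma_p\!\left(\tfrac14\right)^4 \pmod{p^2}&\text{if } p\equiv 3\pmod 4,\end{cases}$$ and $$\sum_{k=1}^{p-1}\binom{2k}{k}^3\frac{O_k^{(2)}}{64^k}\equiv\begin{cases}\dfrac12\,\Gamma_p\!\left(\tfrac14\right)^4E_{p-3}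 \pmod{p}&\text{if } p\equiv 1\pmod 4,\\[1mm] -\dfrac1{16}\,\Gamma_p\!\left(\tfrac14\right)^4 \pmod{p}&\text{if } p\equiv 3\pmod 4.\end{cases}$$ -/

import Mathlib

open Filter Topology

/-- The generalized odd harmonic number `O_k^{(r)} = ∑_{j=1}^{k} 1 / (2j-1)^r`. -/
def oddHarmonic (r k : ℕ) : ℚ :=
  ∑ j ∈ Finset.Icc 1 k, 1 / (2 * (j : ℚ) - 1) ^ r

/-- The truncated sum `∑_{k=1}^{p-1} C(2k,k)^3 O_k^{(r)} / 64^k`. -/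
def truncatedSum (p r : ℕ) : ℚ :=
  ∑ k ∈ Finset.Icc 1 (p - 1), ((2 * k).choose k : ℚ) ^ 3 * oddHarmonic r k / 64 ^ k

/-- The formal power series `cosh t = ∑_{n even} t^n / n!`. -/
noncomputable def coshSeries : PowerSeries ℚ :=
  PowerSeries.mk fun n => if Even n then 1 / (n.factorial : ℚ) else 0

/-- The Euler numbers `E_n`, defined by `1 / cosh t = ∑ E_n t^n / n!`. -/
noncomputable def eulerNumber (n : ℕ) : ℚ :=
  (n.factorial : ℚ) * PowerSeries.coeff n coshSeries⁻¹

/-- The sequence `n ↦ (-1)^n ∏_{0 ≤ k < n, (k,p)=1} k`. -/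
def gammaSeq (p n : ℕ) : ℤ :=
  (-1) ^ n * ∏ k ∈ (Finset.range n).filter (fun k => k.Coprime p), (k : ℤ)

/-- Morita's `p`-adic Gamma function `Γ_p : ℤ_p → ℤ_p`: the extension by continuity of `gammaSeq p`,
that is, `Γ_p(x)` is the limit of `gammaSeq p n` as the natural number `n` tends to `x` in `ℤ_p`. -/
noncomputable def padicGamma (p : ℕ) [Fact p.Prime] (x : ℤ_[p]) : ℤ_[p] :=
  limUnder (comap (Nat.cast : ℕ → ℤ_[p]) (𝓝 x)) fun n : ℕ => (gammaSeq p n : ℤ_[p])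

/-- `x ≡ y (mod p^m)`: the difference lies in `p^m ℤ_p`. -/
def PadicCongr (p : ℕ) [Fact p.Prime] (m : ℕ) (x y : ℚ_[p]) : Prop :=
  ∃ z : ℤ_[p], x - y = (p : ℚ_[p]) ^ m * (z : ℚ_[p])

/-- `1/4` as a `p`-adic integer, for `p` odd. -/
theorem four_mul_inv_four (p : ℕ) [Fact p.Prime] (hp : p ≠ 2) :
    (4 : ℤ_[p]) * PadicInt.inv 4 = 1 := by
  apply PadicInt.mul_inv
  have h : IsUnit ((4 : ℕ) : ℤ_[p]) := by
    rw [PadicInt.isUnit_iff, PadicInt.norm_natCast_eq_one_iff]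
    have := (Nat.coprime_primes (Fact.out : p.Prime) Nat.prime_two).2 hp
    exact Nat.Coprime.pow_right 2 this
  exact PadicInt.isUnit_iff.1 (by exact_mod_cast h)

theorem gammaSeq_succ (p n : ℕ) :
    gammaSeq p (n + 1) = -gammaSeq p n * (if n.Coprime p then (n : ℤ) else 1) := by
  unfold gammaSeq
  rw [Finset.range_add_one, Finset.filter_insert]
  split_ifs with h
  · rw [Finset.prod_insert (by simp)]; ring
  · ring

/-- Wilson's theorem for an odd prime power. -/
theorem prod_units_primePow (p N : ℕ) [Fact p.Prime] (hp : p ≠ 2) (hN : N ≠ 0)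
    [Fintype (ZMod (p ^ N))ˣ] : ∏ x : (ZMod (p ^ N))ˣ, x = -1 := by
  classical
  have hpp : p.Prime := Fact.out
  have : IsCyclic (ZMod (p ^ N))ˣ := ZMod.isCyclic_units_of_prime_pow p hpp hp N
  have h2 : 2 < p ^ N := lt_of_lt_of_le (lt_of_le_of_ne hpp.two_le (Ne.symm hp))
    (Nat.le_self_pow hN p)
  have : Fact (2 < p ^ N) := ⟨h2⟩
  have hne : (-1 : (ZMod (p ^ N))ˣ) ≠ 1 := by
    intro h
    exact ZMod.neg_one_ne_one (congrArg Units.val h)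
  have hsub : ({1, -1} : Finset (ZMod (p ^ N))ˣ) =
      Finset.univ.filter (fun x : (ZMod (p ^ N))ˣ => x ^ 2 = 1) := by
    apply Finset.eq_of_subset_of_card_le
    · intro x hx
      simp only [Finset.mem_insert, Finset.mem_singleton] at hx
      rcases hx with rfl | rfl <;> simp
    · rw [Finset.card_pair hne.symm]
      exact IsCyclic.card_pow_eq_one_le (by norm_num)
  have key : ∀ x : (ZMod (p ^ N))ˣ, x⁻¹ = x → x = 1 ∨ x = -1 := by
    intro x hx
    have : x ∈ Finset.univ.filter (fun x : (ZMod (p ^ N))ˣ => x ^ 2 = 1) := by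
      simp only [Finset.mem_filter, Finset.mem_univ, true_and]
      rw [sq]; nth_rewrite 1 [← hx]; simp
    rw [← hsub] at this
    simpa using this
  have : (∏ x ∈ (Finset.univ : Finset (ZMod (p ^ N))ˣ).erase (-1), x) = 1 := by
    refine Finset.prod_involution (fun x _ => x⁻¹) (by simp) ?_ ?_ (by simp)
    · intro a ha h1 h2
      rcases key a h2 with h | h
      · exact h1 h
      · exact (Finset.mem_erase.1 ha).1 h
    · intro a ha
      simpa [inv_eq_iff_eq_inv] using ha
  rw [← Finset.insert_erase (Finset.mem_univ (-1 : (ZMod (p ^ N))ˣ)),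
    Finset.prod_insert (Finset.notMem_erase _ _), this, mul_one]

theorem gammaSeq_primePow (p N : ℕ) [Fact p.Prime] (hp : p ≠ 2) (hN : N ≠ 0) :
    ((gammaSeq p (p ^ N) : ℤ) : ZMod (p ^ N)) = 1 := by
  classical
  have hpp : p.Prime := Fact.out
  have : NeZero (p ^ N) := ⟨pow_ne_zero _ hpp.ne_zero⟩
  have hodd : Odd (p ^ N) := (hpp.odd_of_ne_two hp).pow
  have hW := congrArg Units.val (prod_units_primePow p N hp hN)
  rw [Units.coe_prod] at hW
  have : ∏ k ∈ (Finset.range (p ^ N)).filter (fun k => k.Coprime p), (k : ZMod (p ^ N))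
      = ∏ x : (ZMod (p ^ N))ˣ, (x : ZMod (p ^ N)) := by
    symm
    refine Finset.prod_bij (fun x _ => (x : ZMod (p ^ N)).val) ?_ ?_ ?_ ?_
    · intro x _
      simp only [Finset.mem_filter, Finset.mem_range]
      exact ⟨ZMod.val_lt _, (Nat.coprime_pow_right_iff (Nat.pos_of_ne_zero hN) _ _).1
        (ZMod.val_coe_unit_coprime x)⟩
    · intro x _ y _ h
      exact Units.ext (ZMod.val_injective _ h)
    · intro k hk
      simp only [Finset.mem_filter, Finset.mem_range] at hk
      refine ⟨ZMod.unitOfCoprime k (hk.2.pow_right N), Finset.mem_univ _, ?_⟩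
      simp [ZMod.val_natCast, Nat.mod_eq_of_lt hk.1]
    · intro x _
      simp
  unfold gammaSeq
  push_cast
  rw [this, hW, hodd.neg_one_pow]
  simp

theorem gammaSeq_add_primePow (p N n : ℕ) [Fact p.Prime] (hp : p ≠ 2) (hN : N ≠ 0) :
    ((gammaSeq p (n + p ^ N) : ℤ) : ZMod (p ^ N)) = gammaSeq p n := by
  induction n with
  | zero => simpa [gammaSeq] using gammaSeq_primePow p N hp hN
  | succ n ih =>
    have h : (n + p ^ N).Coprime p ↔ n.Coprime p := by
      obtain ⟨M, rfl⟩ := Nat.exists_eq_succ_of_ne_zero hN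
      rw [pow_succ, Nat.coprime_add_mul_right_left]
    rw [add_right_comm, gammaSeq_succ, gammaSeq_succ]
    simp only [h]
    have hz : (p : ZMod (p ^ N)) ^ N = 0 := by
      rw [← Nat.cast_pow]; exact ZMod.natCast_self _
    split_ifs <;> push_cast <;> rw [ih] <;> simp [hz]

/-- `gammaSeq p` is `p`-adically uniformly continuous for odd `p`. -/
theorem gammaSeq_modEq (p N m n : ℕ) [Fact p.Prime] (hp : p ≠ 2) (hN : N ≠ 0)
    (h : m ≡ n [MOD p ^ N]) :
    gammaSeq p m ≡ gammaSeq p n [ZMOD ((p ^ N : ℕ) : ℤ)] := by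
  have aux : ∀ a b : ℕ, ((gammaSeq p (a + p ^ N * b) : ℤ) : ZMod (p ^ N)) = gammaSeq p a := by
    intro a b
    induction b with
    | zero => simp
    | succ b ih => rw [mul_add, mul_one, ← add_assoc, gammaSeq_add_primePow p N _ hp hN, ih]
  rw [← ZMod.intCast_eq_intCast_iff, ← Nat.mod_add_div m (p ^ N), ← Nat.mod_add_div n (p ^ N),
    aux, aux, h]

/-- The limit that defines `Γ_p` exists, with the expected rate of convergence. -/
theorem norm_padicGamma_sub_le (p : ℕ) [Fact p.Prime] (hp : p ≠ 2) (N n : ℕ) (hN : N ≠ 0)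
    (x : ℤ_[p]) (h : ‖x - n‖ ≤ (p : ℝ) ^ (-N : ℤ)) :
    ‖padicGamma p x - gammaSeq p n‖ ≤ (p : ℝ) ^ (-N : ℤ) := by
  have hpp : p.Prime := Fact.out
  have hpos : ∀ M : ℕ, (0 : ℝ) < (p : ℝ) ^ (-M : ℤ) := fun M =>
    zpow_pos (by exact_mod_cast hpp.pos) _
  have near : ∀ M : ℕ, M ≠ 0 → ∀ a b : ℕ, ‖x - a‖ ≤ (p : ℝ) ^ (-M : ℤ) →
      ‖x - b‖ ≤ (p : ℝ) ^ (-M : ℤ) →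
      ‖(gammaSeq p a : ℤ_[p]) - gammaSeq p b‖ ≤ (p : ℝ) ^ (-M : ℤ) := by
    intro M hM a b ha hb
    have hab : ‖(((a : ℤ) - b : ℤ) : ℤ_[p])‖ ≤ (p : ℝ) ^ (-M : ℤ) := by
      have : (((a : ℤ) - b : ℤ) : ℤ_[p]) = (x - b) - (x - a) := by push_cast; ring
      rw [this, sub_eq_add_neg]
      refine (PadicInt.nonarchimedean _ _).trans (max_le hb ?_)
      rwa [norm_neg]
    rw [PadicInt.norm_int_le_pow_iff_dvd] at hab
    have hmod : b ≡ a [MOD p ^ M] := (Nat.modEq_iff_dvd).2 (by exact_mod_cast hab)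
    have := (gammaSeq_modEq p M b a hp hM hmod).dvd
    rw [← Int.cast_sub, PadicInt.norm_int_le_pow_iff_dvd]
    exact_mod_cast this
  have hball : ∀ M : ℕ, ∀ᶠ a : ℕ in comap (Nat.cast : ℕ → ℤ_[p]) (𝓝 x),
      ‖x - a‖ ≤ (p : ℝ) ^ (-M : ℤ) := by
    intro M
    refine mem_of_superset (preimage_mem_comap (Metric.closedBall_mem_nhds x (hpos M))) ?_
    intro a ha
    rw [Set.mem_preimage, mem_closedBall_iff_norm'] at ha
    exact ha
  have : (comap (Nat.cast : ℕ → ℤ_[p]) (𝓝 x)).NeBot :=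
    comap_neBot fun t ht => by
      obtain ⟨_, hy, a, rfl⟩ := mem_closure_iff_nhds.1 (PadicInt.denseRange_natCast x) t ht
      exact ⟨a, hy⟩
  have hcauchy : Cauchy (map (fun a : ℕ => (gammaSeq p a : ℤ_[p]))
      (comap (Nat.cast : ℕ → ℤ_[p]) (𝓝 x))) := by
    rw [Metric.cauchy_iff]
    refine ⟨inferInstance, fun ε hε => ?_⟩
    obtain ⟨M, hM⟩ := PadicInt.exists_pow_neg_lt p hε
    have hM' : (p : ℝ) ^ (-(M + 1 : ℕ) : ℤ) < ε := by
      refine lt_of_le_of_lt (zpow_le_zpow_right₀ (by exact_mod_cast hpp.one_lt.le) ?_) hM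
      push_cast; linarith
    refine ⟨_, image_mem_map (hball (M + 1)), ?_⟩
    rintro _ ⟨a, ha, rfl⟩ _ ⟨b, hb, rfl⟩
    rw [dist_eq_norm]
    exact (near (M + 1) (Nat.succ_ne_zero M) a b ha hb).trans_lt hM'
  have hlim : Tendsto (fun a : ℕ => (gammaSeq p a : ℤ_[p]))
      (comap (Nat.cast : ℕ → ℤ_[p]) (𝓝 x)) (𝓝 (padicGamma p x)) :=
    tendsto_nhds_limUnder (CompleteSpace.complete hcauchy)
  refine le_of_tendsto (hlim.sub_const _).norm ?_
  filter_upwards [hball N] with a ha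
  exact near N hN a n ha h

theorem padicGamma_natCast (p : ℕ) [Fact p.Prime] (hp : p ≠ 2) (n : ℕ) :
    padicGamma p n = gammaSeq p n := by
  rw [← sub_eq_zero, ← norm_le_zero_iff]
  refine le_of_forall_pos_le_add fun ε hε => ?_
  obtain ⟨M, hM⟩ := PadicInt.exists_pow_neg_lt p hε
  have hpp : p.Prime := Fact.out
  have h := norm_padicGamma_sub_le p hp (M + 1) n (Nat.succ_ne_zero M) n
    (by rw [sub_self, norm_zero]; exact (zpow_pos (by exact_mod_cast hpp.pos) _).le)
  rw [zero_add]
  refine h.trans ((zpow_le_zpow_right₀ (by exact_mod_cast hpp.one_lt.le) ?_).trans hM.le)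
  push_cast; linarith

theorem continuous_padicGamma (p : ℕ) [Fact p.Prime] (hp : p ≠ 2) :
    Continuous (padicGamma p) := by
  have hpp : p.Prime := Fact.out
  have hpos : ∀ M : ℕ, (0 : ℝ) < (p : ℝ) ^ (-M : ℤ) := fun M =>
    zpow_pos (by exact_mod_cast hpp.pos) _
  rw [Metric.continuous_iff]
  intro x ε hε
  obtain ⟨M, hM⟩ := PadicInt.exists_pow_neg_lt p hε
  have hM' : (p : ℝ) ^ (-(M + 1 : ℕ) : ℤ) < ε := by
    refine lt_of_le_of_lt (zpow_le_zpow_right₀ (by exact_mod_cast hpp.one_lt.le) ?_) hM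
    push_cast; linarith
  refine ⟨_, hpos (M + 1), fun y hy => ?_⟩
  obtain ⟨n, hn⟩ := PadicInt.denseRange_natCast.exists_dist_lt x (hpos (M + 1))
  rw [dist_eq_norm] at hn hy ⊢
  have hyn : ‖y - n‖ ≤ (p : ℝ) ^ (-(M + 1 : ℕ) : ℤ) := by
    rw [← sub_add_sub_cancel y x (n : ℤ_[p])]
    exact (PadicInt.nonarchimedean _ _).trans (max_le hy.le hn.le)
  have h1 := norm_padicGamma_sub_le p hp (M + 1) n (Nat.succ_ne_zero M) x hn.le
  have h2 := norm_padicGamma_sub_le p hp (M + 1) n (Nat.succ_ne_zero M) y hyn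
  rw [← sub_add_sub_cancel _ (gammaSeq p n : ℤ_[p]) _]
  refine ((PadicInt.nonarchimedean _ _).trans (max_le h2 ?_)).trans_lt hM'
  rw [← neg_sub, norm_neg]
  exact h1

/-!
Everything comes from Dixon's evaluation of `₃F₂(a, b, -n; 1 + a - b, 1 + a + n; 1)` with
`n = (p - 1) / 2`. At `a = 1 / 2`, `b = n + 1` its `k`-th term is `(C(2k, k) / 4 ^ k) ^ 3` modulo
`p ^ 2`. Differentiating the evaluation in the direction `(1, 2)`, chosen so that the even
reciprocals `1 / (2j + 2)` cancel to first order, multiplies this term by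
`6 O_k + p (H_k^{(2)} - 4 O_k^{(2)})` modulo `p ^ 2`. Hence the sum with weights `O_k` is known
modulo `p ^ 2` as soon as the sums with weights `H_k^{(2)}` and `O_k^{(2)}` are known modulo `p`.
The reflection `k ↦ n - k` exchanges these two up to a factor, and the sum with weights `H_k^{(2)}`
is the derivative at `e = 0` of Whipple's sum `₃F₂(-n, n + 1, 1 / 2; 1 + √e / 2, 1 - √e / 2; 1)`.

The terms with `k > n` do not matter, because there `C(2k, k)` is divisible by `p` while `O_k^{(r)}`
has at most `p ^ r` in its denominator. By Wilson's theorem the remaining products are factorials,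
which are the residues of powers of `Γ_p(1 / 4)`. Finally `H_m^{(2)}` with `m = (p - 1) / 4` is,
modulo `p`, four times an alternating sum of `(p - 3)`-rd powers of odd numbers, and such
alternating sums satisfy the recursion of the Euler numbers.
-/

section PadicCongruences

variable {p : ℕ} [Fact p.Prime]

theorem padicCongr_iff_norm_sub_le {m : ℕ} {x y : ℚ_[p]} :
    PadicCongr p m x y ↔ ‖x - y‖ ≤ (p : ℝ) ^ (-m : ℤ) := by
  have hp : (p : ℚ_[p]) ≠ 0 := Nat.cast_ne_zero.2 (Fact.out : p.Prime).ne_zero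
  constructor
  · rintro ⟨z, hz⟩
    rw [hz, norm_mul, Padic.norm_p_pow]
    exact mul_le_of_le_one_right (by positivity) z.norm_le_one
  · intro h
    refine ⟨⟨(x - y) / (p : ℚ_[p]) ^ m, ?_⟩, (mul_div_cancel₀ _ (pow_ne_zero m hp)).symm⟩
    rw [norm_div, Padic.norm_p_pow]
    exact div_le_one_of_le₀ h (by positivity)

namespace PadicCongr

variable {m : ℕ} {x x' y y' z c : ℚ_[p]}

theorem refl (m : ℕ) (x : ℚ_[p]) : PadicCongr p m x x := ⟨0, by simp⟩

theorem symm (h : PadicCongr p m x y) : PadicCongr p m y x := by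
  rwa [padicCongr_iff_norm_sub_le, norm_sub_rev, ← padicCongr_iff_norm_sub_le]

theorem add (h : PadicCongr p m x y) (h' : PadicCongr p m x' y') :
    PadicCongr p m (x + x') (y + y') := by
  rw [padicCongr_iff_norm_sub_le] at h h' ⊢
  rw [add_sub_add_comm]
  exact (IsUltrametricDist.norm_add_le_max _ _).trans (max_le h h')

theorem sub (h : PadicCongr p m x y) (h' : PadicCongr p m x' y') :
    PadicCongr p m (x - x') (y - y') := by
  obtain ⟨z, hz⟩ := h
  obtain ⟨z', hz'⟩ := h'
  exact ⟨z - z', by rw [sub_sub_sub_comm, hz, hz', PadicInt.coe_sub, mul_sub]⟩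

theorem trans (h : PadicCongr p m x y) (h' : PadicCongr p m y z) : PadicCongr p m x z := by
  rw [padicCongr_iff_norm_sub_le] at h h' ⊢
  rw [← sub_add_sub_cancel x y z]
  exact (IsUltrametricDist.norm_add_le_max _ _).trans (max_le h h')

theorem mul_left (hc : ‖c‖ ≤ 1) (h : PadicCongr p m x y) : PadicCongr p m (c * x) (c * y) := by
  rw [padicCongr_iff_norm_sub_le] at h ⊢
  rw [← mul_sub, norm_mul]
  exact (mul_le_of_le_one_left (norm_nonneg _) hc).trans h

theorem of_mul_left (hc : ‖c‖ = 1) (h : PadicCongr p m (c * x) (c * y)) :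
    PadicCongr p m x y := by
  rwa [padicCongr_iff_norm_sub_le, ← mul_sub, norm_mul, hc, one_mul,
    ← padicCongr_iff_norm_sub_le] at h

theorem mul (h : PadicCongr p m x y) (h' : PadicCongr p m x' y') (hx : ‖x‖ ≤ 1)
    (hy' : ‖y'‖ ≤ 1) : PadicCongr p m (x * x') (y * y') := by
  refine (mul_left hx h').trans ?_
  rw [mul_comm x, mul_comm y]
  exact mul_left hy' h

theorem div (h : PadicCongr p m x y) (h' : PadicCongr p m x' y') (hx : ‖x‖ ≤ 1)
    (hx' : ‖x'‖ = 1) (hy' : ‖y'‖ = 1) : PadicCongr p m (x / x') (y / y') := by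
  have ne_zero_of_norm {z : ℚ_[p]} (hz : ‖z‖ = 1) : z ≠ 0 := norm_ne_zero_iff.1 (by simp [hz])
  refine of_mul_left (c := x' * y') (by rw [norm_mul, hx', hy', one_mul]) ?_
  convert mul h h'.symm hx hx'.le using 1
  · field [ne_zero_of_norm hx']
  · field [ne_zero_of_norm hy']

theorem prime_mul (h : PadicCongr p m x y) : PadicCongr p (m + 1) (p * x) (p * y) := by
  obtain ⟨z, hz⟩ := h
  exact ⟨z, by rw [← mul_sub, hz]; ring⟩

theorem div_prime (h : PadicCongr p (m + 1) x y) :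
    PadicCongr p m (x / (p : ℚ_[p])) (y / (p : ℚ_[p])) := by
  have hp : (p : ℚ_[p]) ≠ 0 := Nat.cast_ne_zero.2 (Fact.out : p.Prime).ne_zero
  obtain ⟨z, hz⟩ := h
  exact ⟨z, by rw [← sub_div, hz]; field⟩

variable {ι : Type*} {s : Finset ι} {f g : ι → ℚ_[p]}

theorem sum (h : ∀ i ∈ s, PadicCongr p m (f i) (g i)) :
    PadicCongr p m (∑ i ∈ s, f i) (∑ i ∈ s, g i) := by
  simp only [padicCongr_iff_norm_sub_le] at h ⊢
  rw [← Finset.sum_sub_distrib]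
  exact IsUltrametricDist.norm_sum_le_of_forall_le_of_nonneg (by positivity) h

theorem prod (h : ∀ i ∈ s, PadicCongr p m (f i) (g i)) (hf : ∀ i ∈ s, ‖f i‖ ≤ 1)
    (hg : ∀ i ∈ s, ‖g i‖ ≤ 1) : PadicCongr p m (∏ i ∈ s, f i) (∏ i ∈ s, g i) := by
  classical
  induction s using Finset.induction_on with
  | empty => exact refl m 1
  | insert i s hi ih =>
    rw [Finset.forall_mem_insert] at h hf hg
    rw [Finset.prod_insert hi, Finset.prod_insert hi]
    refine mul h.1 (ih h.2 hf.2 hg.2) hf.1 ((Finset.norm_prod_le s g).trans ?_)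
    exact Finset.prod_le_one (fun _ _ => norm_nonneg _) hg.2

end PadicCongr

/-- The graph of reduction modulo `p`, as a subring of `ℚ_[p] × ZMod p`. Since only `p`-adic
integers can be reduced, it is the range of `ℤ_[p]`; being a subring encodes that reduction is
compatible with finite sums and products. -/
noncomputable def residueGraph (p : ℕ) [Fact p.Prime] : Subring (ℚ_[p] × ZMod p) :=
  (PadicInt.Coe.ringHom.prod PadicInt.toZMod).range

/-- The `p`-adic number `x` is integral and its residue class modulo `p` is `y`. -/
def HasResidue (x : ℚ_[p]) (y : ZMod p) : Prop :=
  (x, y) ∈ residueGraph p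

namespace HasResidue

variable {x x' : ℚ_[p]} {y y' : ZMod p}

theorem coe (z : ℤ_[p]) : HasResidue (z : ℚ_[p]) (PadicInt.toZMod z) := ⟨z, rfl⟩

theorem exists_eq_coe (h : HasResidue x y) :
    ∃ z : ℤ_[p], x = z ∧ y = PadicInt.toZMod z := by
  obtain ⟨z, hz⟩ := h
  exact ⟨z, (congrArg Prod.fst hz).symm, (congrArg Prod.snd hz).symm⟩

theorem add (h : HasResidue x y) (h' : HasResidue x' y') : HasResidue (x + x') (y + y') :=
  (residueGraph p).add_mem h h'

theorem sub (h : HasResidue x y) (h' : HasResidue x' y') : HasResidue (x - x') (y - y') :=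
  (residueGraph p).sub_mem h h'

theorem neg (h : HasResidue x y) : HasResidue (-x) (-y) :=
  (residueGraph p).neg_mem h

theorem mul (h : HasResidue x y) (h' : HasResidue x' y') : HasResidue (x * x') (y * y') :=
  (residueGraph p).mul_mem h h'

theorem pow (h : HasResidue x y) (n : ℕ) : HasResidue (x ^ n) (y ^ n) :=
  (residueGraph p).pow_mem h n

theorem natCast (n : ℕ) : HasResidue (n : ℚ_[p]) (n : ZMod p) :=
  natCast_mem (residueGraph p) n

theorem intCast (n : ℤ) : HasResidue (n : ℚ_[p]) (n : ZMod p) :=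
  intCast_mem (residueGraph p) n

theorem zero : HasResidue (0 : ℚ_[p]) 0 := zero_mem (residueGraph p)

theorem one : HasResidue (1 : ℚ_[p]) 1 := one_mem (residueGraph p)

theorem ofNat (n : ℕ) [n.AtLeastTwo] :
    HasResidue (OfNat.ofNat n : ℚ_[p]) (OfNat.ofNat n : ZMod p) := natCast n

theorem prime : HasResidue (p : ℚ_[p]) 0 := by simpa using natCast (p := p) p

theorem sum {ι : Type*} {s : Finset ι} {f : ι → ℚ_[p]} {g : ι → ZMod p}
    (h : ∀ i ∈ s, HasResidue (f i) (g i)) : HasResidue (∑ i ∈ s, f i) (∑ i ∈ s, g i) := by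
  rw [HasResidue, prod_mk_sum]
  exact sum_mem h

theorem prod {ι : Type*} {s : Finset ι} {f : ι → ℚ_[p]} {g : ι → ZMod p}
    (h : ∀ i ∈ s, HasResidue (f i) (g i)) : HasResidue (∏ i ∈ s, f i) (∏ i ∈ s, g i) := by
  rw [HasResidue, prod_mk_prod]
  exact prod_mem h

theorem norm_le_one (h : HasResidue x y) : ‖x‖ ≤ 1 := by
  obtain ⟨z, rfl, -⟩ := h.exists_eq_coe
  exact z.norm_le_one

theorem norm_eq_one (h : HasResidue x y) (hy : y ≠ 0) : ‖x‖ = 1 := by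
  obtain ⟨z, rfl, rfl⟩ := h.exists_eq_coe
  refine z.norm_le_one.antisymm (not_lt.1 fun hz => hy ?_)
  rwa [← RingHom.mem_ker, PadicInt.ker_toZMod, IsLocalRing.mem_maximalIdeal,
    PadicInt.mem_nonunits]

theorem inv (h : HasResidue x y) (hy : y ≠ 0) : HasResidue x⁻¹ y⁻¹ := by
  have hx := h.norm_eq_one hy
  obtain ⟨z, rfl, rfl⟩ := h.exists_eq_coe
  obtain ⟨w, hw⟩ := (PadicInt.isUnit_iff.2 hx).exists_right_inv
  convert coe w
  · exact inv_eq_of_mul_eq_one_right (by rw [← PadicInt.coe_mul, hw, PadicInt.coe_one])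
  · exact inv_eq_of_mul_eq_one_right (by rw [← map_mul, hw, map_one])

theorem div (h : HasResidue x y) (h' : HasResidue x' y') (hy' : y' ≠ 0) :
    HasResidue (x / x') (y / y') := by
  simpa only [div_eq_mul_inv] using h.mul (h'.inv hy')

theorem zero_iff : HasResidue x 0 ↔ PadicCongr p 1 x 0 := by
  constructor
  · intro h
    obtain ⟨z, rfl, hz⟩ := h.exists_eq_coe
    have hz : z ∈ IsLocalRing.maximalIdeal ℤ_[p] := by
      rw [← PadicInt.ker_toZMod, RingHom.mem_ker, hz]
    rw [PadicInt.maximalIdeal_eq_span_p, Ideal.mem_span_singleton] at hz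
    obtain ⟨w, rfl⟩ := hz
    exact ⟨w, by simp⟩
  · rintro ⟨w, hw⟩
    rw [sub_zero, pow_one] at hw
    rw [hw]
    simpa using prime.mul (coe w)

theorem unique (h : HasResidue x y) (h' : HasResidue x y') : y = y' := by
  obtain ⟨z, hz, hy⟩ := h.exists_eq_coe
  obtain ⟨z', hz', hy'⟩ := h'.exists_eq_coe
  rw [hy, hy', PadicInt.ext (hz.symm.trans hz')]

theorem padicCongr (h : HasResidue x y) (h' : HasResidue x' y) : PadicCongr p 1 x x' := by
  have := zero_iff.1 (by simpa using h.sub h')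
  rwa [PadicCongr, sub_zero] at this

theorem of_padicCongr (h : HasResidue x y) (h' : PadicCongr p 1 x' x) : HasResidue x' y := by
  have : HasResidue (x' - x) 0 := zero_iff.2 (by rwa [PadicCongr, sub_zero])
  simpa using this.add h

theorem padicCongr_prime_mul {x x' : ℚ_[p]} {y : ZMod p}
    (h : HasResidue (x / (p : ℚ_[p])) y) (h' : HasResidue x' y) : PadicCongr p 2 x (p * x') := by
  simpa only [mul_div_cancel₀ x (NeZero.ne (p : ℚ_[p]))] using (h.padicCongr h').prime_mul

end HasResidue

theorem norm_prime_mul_le {z : ℚ_[p]} (hz : ‖z‖ ≤ 1) : ‖p * z‖ ≤ (p : ℝ)⁻¹ := by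
  rw [norm_mul, Padic.norm_p]
  exact mul_le_of_le_one_right (by positivity) hz

theorem padicCongr_inv_add_prime_mul {x z : ℚ_[p]} (hx : ‖x‖ = 1) (hz : ‖z‖ ≤ 1) :
    PadicCongr p 2 (x + p * z)⁻¹ (x⁻¹ - p * z / x ^ 2) := by
  have hpz := norm_prime_mul_le hz
  have hp : (p : ℝ)⁻¹ < 1 := inv_lt_one_of_one_lt₀ (Nat.one_lt_cast.2 (Fact.out : p.Prime).one_lt)
  have hxz : ‖x + p * z‖ = 1 := by
    rw [IsUltrametricDist.norm_add_eq_max_of_norm_ne_norm (by linarith), hx]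
    exact max_eq_left (hpz.trans hp.le)
  have hx0 : x ≠ 0 := norm_ne_zero_iff.1 (by simp [hx])
  have hxz0 : x + p * z ≠ 0 := norm_ne_zero_iff.1 (by simp [hxz])
  have remainder : (x + p * z)⁻¹ - (x⁻¹ - p * z / x ^ 2) = (p * z) ^ 2 / (x ^ 2 * (x + p * z)) := by
    field
  rw [padicCongr_iff_norm_sub_le, remainder, norm_div, norm_mul, norm_pow, norm_pow, hx, hxz,
    one_pow, one_mul, div_one, zpow_neg, zpow_natCast, ← inv_pow]
  gcongr

end PadicCongruences

section HypergeometricSums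

open Finset

variable {K : Type*} [Field K]

/-- The `k`-th term of the terminating well-poised series `₃F₂(a, b, -n; 1 + a - b, 1 + a + n; 1)`
summed by Dixon's theorem, written as the product of its successive term ratios. -/
def dixonTerm (a b : K) (n k : ℕ) : K :=
  ∏ j ∈ range k, (a + j) * (b + j) * (j - n) / ((j + 1) * (1 + a - b + j) * (1 + a + n + j))

theorem dixonTerm_zero (a b : K) (n : ℕ) : dixonTerm a b n 0 = 1 := prod_range_zero _

theorem dixonTerm_succ (a b : K) (n k : ℕ) :
    dixonTerm a b n (k + 1) = dixonTerm a b n k *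
      ((a + k) * (b + k) * (k - n) / ((k + 1) * (1 + a - b + k) * (1 + a + n + k))) :=
  prod_range_succ _ _

theorem dixonTerm_self_add_one (a b : K) (n : ℕ) : dixonTerm a b n (n + 1) = 0 := by
  simp [dixonTerm_succ]

theorem dixonTerm_succ_succ (a b : K) (n k : ℕ) :
    dixonTerm a b (n + 1) (k + 1) = a * b * dixonTerm (a + 1) (b + 1) n k *
      (-(n + 1) / ((k + 1) * (1 + a - b + k) * (2 + a + n + k))) := by
  induction k with
  | zero => simp only [dixonTerm_succ, dixonTerm_zero]; push_cast; ring
  | succ k ih => rw [dixonTerm_succ, ih, dixonTerm_succ]; push_cast; ring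

theorem mul_dixonTerm_succ {a b : K} {n : ℕ} (k : ℕ) (h : 1 + a + n ≠ 0) :
    (1 + a + n) * dixonTerm a b n (k + 1) = a * b * dixonTerm (a + 1) (b + 1) n k *
      ((k - n) / ((k + 1) * (1 + a - b + k))) := by
  induction k with
  | zero =>
    simp only [dixonTerm_succ, dixonTerm_zero, Nat.cast_zero, add_zero]
    field
  | succ k ih =>
    rw [dixonTerm_succ, ← mul_assoc, ih, dixonTerm_succ]
    push_cast
    simp only [div_eq_mul_inv, mul_inv]
    ring

/-- The `k`-th term of the terminating series `₃F₂(-n, n + 1, 1/2; 1 + √e/2, 1 - √e/2; 1)` summed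
by Whipple's theorem, written as the product of its successive term ratios. All factors of the
ratios have been doubled, so that no fraction occurs in them. -/
def whippleTerm (e : K) (n k : ℕ) : K :=
  ∏ j ∈ range k,
    (2 * j + 1) * ((2 * j + 1) ^ 2 - (2 * n + 1) ^ 2) / ((2 * j + 2) * ((2 * j + 2) ^ 2 - e))

theorem whippleTerm_zero (e : K) (n : ℕ) : whippleTerm e n 0 = 1 := prod_range_zero _

theorem whippleTerm_succ (e : K) (n k : ℕ) :
    whippleTerm e n (k + 1) = whippleTerm e n k *
      ((2 * k + 1) * ((2 * k + 1) ^ 2 - (2 * n + 1) ^ 2) /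
        ((2 * k + 2) * ((2 * k + 2) ^ 2 - e))) :=
  prod_range_succ _ _

theorem whippleTerm_self_add_one (e : K) (n : ℕ) : whippleTerm e n (n + 1) = 0 := by
  simp [whippleTerm_succ]

theorem whippleTerm_self_add_two (e : K) (n : ℕ) : whippleTerm e n (n + 2) = 0 := by
  rw [whippleTerm_succ, whippleTerm_self_add_one, zero_mul]

theorem whippleTerm_add_two_succ (e : K) (n k : ℕ) :
    whippleTerm e (n + 2) (k + 1) = whippleTerm e (n + 1) k *
      (-(2 * n + 2 * k + 4) * (2 * n + 2 * k + 6) * (2 * k + 1) /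
        ((2 * k + 2) * ((2 * k + 2) ^ 2 - e))) := by
  induction k with
  | zero => simp only [whippleTerm_succ, whippleTerm_zero]; push_cast; ring
  | succ k ih => rw [whippleTerm_succ, ih, whippleTerm_succ]; push_cast; ring

theorem whippleTerm_succ_eq_add_one (e : K) (n k : ℕ) :
    whippleTerm e n (k + 1) = whippleTerm e (n + 1) k *
      (-(2 * k - 2 * n - 2) * (2 * k - 2 * n) * (2 * k + 1) /
        ((2 * k + 2) * ((2 * k + 2) ^ 2 - e))) := by
  induction k with
  | zero => simp only [whippleTerm_succ, whippleTerm_zero]; push_cast; ring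
  | succ k ih => rw [whippleTerm_succ, ih, whippleTerm_succ]; push_cast; ring

variable [CharZero K]

-- For `k = n + 1` the right-hand side vanishes, which leaves a first order recurrence in `n`.
theorem sum_dixonTerm_telescope (a b : K) (n k : ℕ) (h₁ : ∀ j < k, 1 + a - b + j ≠ 0)
    (h₂ : ∀ j < k, 2 + a + n + j ≠ 0) (h₃ : 1 + a + n ≠ 0) :
    ∑ i ∈ range (k + 1), ((1 + a / 2 + n) * (1 + a - b + n) * dixonTerm a b (n + 1) i -
        (1 + a / 2 - b + n) * ((1 + a + n) * dixonTerm a b n i)) =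
      a * b / 2 * dixonTerm (a + 1) (b + 1) n k := by
  induction k with
  | zero =>
    simp only [zero_add, sum_range_one, dixonTerm_zero]
    ring
  | succ k ih =>
    have hk₁ := h₁ k k.lt_succ_self
    have hk₂ := h₂ k k.lt_succ_self
    have hk : (k + 1 : K) ≠ 0 := k.cast_add_one_ne_zero
    rw [sum_range_succ, ih (fun j hj => h₁ j (by omega)) (fun j hj => h₂ j (by omega)),
      dixonTerm_succ_succ, mul_dixonTerm_succ k h₃, dixonTerm_succ (a + 1)]
    rw [show 1 + (a + 1) - (b + 1) + (k : K) = 1 + a - b + k by ring,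
      show 1 + (a + 1) + (n : K) + k = 2 + a + n + k by ring]
    field_simp
    ring

theorem sum_dixonTerm (a b : K) (n : ℕ) (h₁ : ∀ j < n, 1 + a - b + j ≠ 0)
    (h₂ : ∀ j < 2 * n, 1 + a + j ≠ 0) (h₃ : ∀ j < n, 1 + a / 2 + j ≠ 0) :
    ∑ k ∈ range (n + 1), dixonTerm a b n k =
      ∏ j ∈ range n,
        (1 + a + j) * (1 + a / 2 - b + j) / ((1 + a / 2 + j) * (1 + a - b + j)) := by
  induction n with
  | zero => simp [dixonTerm_zero]
  | succ n ih =>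
    have recurrence := sum_dixonTerm_telescope a b n (n + 1) h₁
      (fun j hj => by convert h₂ (n + 1 + j) (by omega) using 1; push_cast; ring)
      (h₂ n (by omega))
    rw [dixonTerm_self_add_one, mul_zero, sum_sub_distrib, ← mul_sum, ← mul_sum, ← mul_sum,
      sum_range_succ (dixonTerm a b n), dixonTerm_self_add_one, add_zero,
      ih (fun j hj => h₁ j (by omega)) (fun j hj => h₂ j (by omega))
        (fun j hj => h₃ j (by omega))] at recurrence
    rw [prod_range_succ, ← mul_div_assoc,
      eq_div_iff (mul_ne_zero (h₃ n n.lt_succ_self) (h₁ n n.lt_succ_self))]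
    linear_combination recurrence

-- For `k = n + 2` the right-hand side vanishes, which leaves a recurrence in `n` of step two.
theorem sum_whippleTerm_telescope (e : K) (n k : ℕ) (h : ∀ j < k, (2 * j + 2 : K) ^ 2 - e ≠ 0) :
    ∑ i ∈ range (k + 1), (((2 * n + 4) ^ 2 - e) * whippleTerm e (n + 2) i -
        ((2 * n + 2) ^ 2 - e) * whippleTerm e n i) =
      4 * (2 * n + 3) * (2 * k + 1) * whippleTerm e (n + 1) k := by
  induction k with
  | zero =>
    simp only [zero_add, sum_range_one, whippleTerm_zero]
    push_cast
    ring
  | succ k ih =>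
    have hk := h k k.lt_succ_self
    have hk' : (2 * k + 2 : K) ≠ 0 := by exact_mod_cast (2 * k + 1).succ_ne_zero
    have hD := mul_ne_zero hk' hk
    rw [sum_range_succ, ih fun j hj => h j (by omega), whippleTerm_add_two_succ,
      whippleTerm_succ_eq_add_one, whippleTerm_succ]
    push_cast
    generalize hD' : (2 * k + 2 : K) * ((2 * k + 2) ^ 2 - e) = D at hD ⊢
    field_simp
    rw [← hD']
    ring

theorem sum_whippleTerm_add_two (e : K) (n : ℕ) (h : ∀ j < n + 2, (2 * j + 2 : K) ^ 2 - e ≠ 0) :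
    ((2 * n + 4) ^ 2 - e) * ∑ k ∈ range (n + 3), whippleTerm e (n + 2) k =
      ((2 * n + 2) ^ 2 - e) * ∑ k ∈ range (n + 1), whippleTerm e n k := by
  have telescope := sum_whippleTerm_telescope e n (n + 2) h
  rwa [whippleTerm_self_add_one, mul_zero, sum_sub_distrib, ← mul_sum, ← mul_sum, sub_eq_zero,
    sum_range_succ (whippleTerm e n), whippleTerm_self_add_two, add_zero,
    sum_range_succ (whippleTerm e n), whippleTerm_self_add_one, add_zero] at telescope

theorem sum_whippleTerm_even (e : K) (m : ℕ) (h : ∀ j < 2 * m, (2 * j + 2 : K) ^ 2 - e ≠ 0) :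
    ∑ k ∈ range (2 * m + 1), whippleTerm e (2 * m) k =
      ∏ j ∈ range m, ((4 * j + 2) ^ 2 - e) / ((4 * j + 4) ^ 2 - e) := by
  induction m with
  | zero => simp [whippleTerm_zero]
  | succ m ih =>
    have recurrence := sum_whippleTerm_add_two e (2 * m) fun j hj => h j (by omega)
    have hm : (4 * m + 4 : K) ^ 2 - e ≠ 0 := by
      convert h (2 * m + 1) (by omega) using 2; push_cast; ring
    rw [ih fun j hj => h j (by omega)] at recurrence
    rw [prod_range_succ, ← mul_div_assoc, eq_div_iff hm]
    push_cast at recurrence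
    linear_combination recurrence

theorem sum_whippleTerm_odd (e : K) (m : ℕ)
    (h : ∀ j < 2 * m + 1, (2 * j + 2 : K) ^ 2 - e ≠ 0) :
    ∑ k ∈ range (2 * m + 2), whippleTerm e (2 * m + 1) k =
      -e / (4 - e) * ∏ j ∈ range m, ((4 * j + 4) ^ 2 - e) / ((4 * j + 6) ^ 2 - e) := by
  induction m with
  | zero =>
    have h4 : 4 - e ≠ 0 := by convert h 0 one_pos using 1; push_cast; ring
    rw [sum_range_succ, sum_range_one, whippleTerm_succ, whippleTerm_zero, prod_range_zero]
    push_cast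
    rw [show (2 * 0 + 2 : K) ^ 2 - e = 4 - e by ring]
    field_simp
    ring
  | succ m ih =>
    have recurrence := sum_whippleTerm_add_two e (2 * m + 1) fun j hj => h j (by omega)
    have hm : (4 * m + 6 : K) ^ 2 - e ≠ 0 := by
      convert h (2 * m + 2) (by omega) using 2; push_cast; ring
    rw [ih fun j hj => h j (by omega)] at recurrence
    rw [prod_range_succ, ← mul_assoc, ← mul_div_assoc, eq_div_iff hm]
    push_cast at recurrence
    linear_combination recurrence

theorem dixonTerm_half_eq_whippleTerm (n k : ℕ) :
    dixonTerm (1 / 2 : K) (n + 1) n k = whippleTerm ((2 * n + 1 : K) ^ 2) n k := by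
  refine prod_congr rfl fun j _ => ?_
  rw [← mul_div_mul_left _ _ (by norm_num : (8 : K) ≠ 0)]
  congr 1 <;> ring

end HypergeometricSums

section LogDerivative

open Finset

variable {𝕜 : Type*} [NontriviallyNormedField 𝕜]

/-- The function `f` has logarithmic derivative `l` at `x`, in the form `f' = f * l`, so that
`f x = 0` is allowed. -/
def HasLogDerivAt (f : 𝕜 → 𝕜) (l x : 𝕜) : Prop := HasDerivAt f (f x * l) x

namespace HasLogDerivAt

variable {f g : 𝕜 → 𝕜} {l m x : 𝕜}

theorem mul (hf : HasLogDerivAt f l x) (hg : HasLogDerivAt g m x) :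
    HasLogDerivAt (fun y => f y * g y) (l + m) x :=
  (HasDerivAt.fun_mul hf hg).congr_deriv (by ring)

theorem div (hf : HasLogDerivAt f l x) (hg : HasLogDerivAt g m x) (hx : g x ≠ 0) :
    HasLogDerivAt (fun y => f y / g y) (l - m) x :=
  (HasDerivAt.fun_div hf hg hx).congr_deriv (by field)

theorem const (c : 𝕜) : HasLogDerivAt (fun _ => c) 0 x :=
  (hasDerivAt_const x c).congr_deriv (mul_zero c).symm

theorem prod {ι : Type*} {s : Finset ι} {f : ι → 𝕜 → 𝕜} {l : ι → 𝕜}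
    (h : ∀ i ∈ s, HasLogDerivAt (f i) (l i) x) :
    HasLogDerivAt (fun y => ∏ i ∈ s, f i y) (∑ i ∈ s, l i) x := by
  classical
  induction s using Finset.induction_on with
  | empty => simpa using const (1 : 𝕜)
  | insert i s hi ih =>
    simp only [prod_insert hi, sum_insert hi]
    exact (h i (by simp)).mul (ih fun j hj => h j (by simp [hj]))

theorem affine {c : 𝕜} (r : 𝕜) (hf : ∀ y, f y = c + r * y) (hc : c ≠ 0) :
    HasLogDerivAt f (r / c) 0 := by
  obtain rfl : f = fun y => c + r * y := funext hf
  exact (((hasDerivAt_id' (0 : 𝕜)).const_mul r).const_add c).congr_deriv (by field)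

end HasLogDerivAt

theorem eventually_forall_lt_ne_zero {f : ℕ → 𝕜 → 𝕜} {x : 𝕜} (hf : ∀ j, ContinuousAt (f j) x)
    (hx : ∀ j, f j x ≠ 0) (n : ℕ) : ∀ᶠ y in 𝓝 x, ∀ j < n, f j y ≠ 0 :=
  (eventually_all_finite (Set.finite_Iio n)).2 fun j _ => (hf j).eventually_ne (hx j)

theorem hasLogDerivAt_dixonTerm {a b : 𝕜} (r s : 𝕜) (n k : ℕ) (ha : ∀ j : ℕ, a + j ≠ 0)
    (hb : ∀ j : ℕ, b + j ≠ 0) (hab : ∀ j : ℕ, 1 + a - b + j ≠ 0) (hk : ∀ j : ℕ, (j + 1 : 𝕜) ≠ 0) :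
    HasLogDerivAt (fun x => dixonTerm (a + r * x) (b + s * x) n k)
      (∑ j ∈ range k,
        (r / (a + j) + s / (b + j) - (r - s) / (1 + a - b + j) - r / (1 + a + n + j))) 0 := by
  refine HasLogDerivAt.prod fun j _ => ?_
  have han : 1 + a + n + j ≠ 0 := by convert ha (n + j + 1) using 1; push_cast; ring
  have numerator := ((HasLogDerivAt.affine r (fun y => add_right_comm a (r * y) j) (ha j)).mul
    (HasLogDerivAt.affine s (fun y => add_right_comm b (s * y) j) (hb j))).mul
      (HasLogDerivAt.const (j - n : 𝕜))
  have denominator := ((HasLogDerivAt.const (j + 1 : 𝕜)).mul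
    (HasLogDerivAt.affine (f := fun y => 1 + (a + r * y) - (b + s * y) + j) (r - s)
      (fun y => by ring) (hab j))).mul
    (HasLogDerivAt.affine (f := fun y => 1 + (a + r * y) + n + j) r (fun y => by ring) han)
  convert numerator.div denominator (by simpa using ⟨⟨hk j, hab j⟩, han⟩) using 1
  ring

theorem sum_dixonTerm_mul_logDeriv [CharZero 𝕜] {a b : 𝕜} (r s : 𝕜) (n : ℕ)
    (ha : ∀ j : ℕ, a + j ≠ 0) (hb : ∀ j : ℕ, b + j ≠ 0) (hab : ∀ j : ℕ, 1 + a - b + j ≠ 0)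
    (ha' : ∀ j : ℕ, 1 + a / 2 + j ≠ 0) (hab' : ∀ j : ℕ, 1 + a / 2 - b + j ≠ 0) :
    ∑ k ∈ range (n + 1), dixonTerm a b n k * ∑ j ∈ range k,
        (r / (a + j) + s / (b + j) - (r - s) / (1 + a - b + j) - r / (1 + a + n + j)) =
      (∑ k ∈ range (n + 1), dixonTerm a b n k) * ∑ j ∈ range n,
        (r / (1 + a + j) + (r / 2 - s) / (1 + a / 2 - b + j) -
          (r / 2 / (1 + a / 2 + j) + (r - s) / (1 + a - b + j))) := by
  have ha₁ (j : ℕ) : 1 + a + j ≠ 0 := by convert ha (j + 1) using 1; push_cast; ring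
  have sum_deriv := HasDerivAt.fun_sum (u := range (n + 1)) fun k _ =>
    hasLogDerivAt_dixonTerm r s n k ha hb hab Nat.cast_add_one_ne_zero
  have prod_logDeriv : HasLogDerivAt (fun x => ∏ j ∈ range n,
      (1 + (a + r * x) + j) * (1 + (a + r * x) / 2 - (b + s * x) + j) /
        ((1 + (a + r * x) / 2 + j) * (1 + (a + r * x) - (b + s * x) + j)))
      (∑ j ∈ range n, (r / (1 + a + j) + (r / 2 - s) / (1 + a / 2 - b + j) -
          (r / 2 / (1 + a / 2 + j) + (r - s) / (1 + a - b + j)))) 0 := by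
    refine HasLogDerivAt.prod fun j _ => HasLogDerivAt.div
      (.mul (.affine _ (fun y => ?_) (ha₁ j)) (.affine _ (fun y => ?_) (hab' j)))
      (.mul (.affine _ (fun y => ?_) (ha' j)) (.affine _ (fun y => ?_) (hab j)))
      (by simpa using ⟨ha' j, hab j⟩) <;> ring
  have sum_eq_prod : (fun x => ∑ k ∈ range (n + 1), dixonTerm (a + r * x) (b + s * x) n k) =ᶠ[𝓝 0]
      fun x => ∏ j ∈ range n, (1 + (a + r * x) + j) * (1 + (a + r * x) / 2 - (b + s * x) + j) /
        ((1 + (a + r * x) / 2 + j) * (1 + (a + r * x) - (b + s * x) + j)) := by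
    filter_upwards [
      eventually_forall_lt_ne_zero (f := fun j x => 1 + (a + r * x) - (b + s * x) + j) (x := 0)
        (by fun_prop) (by simpa using hab) n,
      eventually_forall_lt_ne_zero (f := fun j x => 1 + (a + r * x) + j) (x := 0)
        (by fun_prop) (by simpa using ha₁) (2 * n),
      eventually_forall_lt_ne_zero (f := fun j x => 1 + (a + r * x) / 2 + j) (x := 0)
        (by fun_prop) (by simpa using ha') n] with x h₁ h₂ h₃
    exact sum_dixonTerm _ _ n h₁ h₂ h₃
  have derivs_eq := sum_deriv.unique (HasDerivAt.congr_of_eventuallyEq prod_logDeriv sum_eq_prod)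
  dsimp only at derivs_eq
  rw [← sum_eq_prod.eq_of_nhds] at derivs_eq
  simpa only [mul_zero, add_zero] using derivs_eq

end LogDerivative

section WhippleDerivative

open Finset

/-- The logarithmic derivative of the `k`-th term of Dixon's sum at `a = 1 / 2`, `b = (q + 1) / 2`
in the direction `(1, 2)`, where `q = 2 * n + 1`. It is a function of `q` because the case of
interest is `q = p`, a small perturbation of `q = 0`. -/
def dixonTermLogDeriv {K : Type*} [Field K] (q : K) (k : ℕ) : K :=
  ∑ j ∈ range k,
    (2 / (2 * j + 1) + 4 / (2 * j + 1 + q) + 2 / (2 * j + 2 - q) - 2 / (2 * j + 2 + q))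

/-- The logarithmic derivative of Dixon's sum at `a = 1 / 2`, `b = n + 1` in the direction
`(1, 2)`. -/
def dixonSumLogDeriv (K : Type*) [Field K] (n : ℕ) : K :=
  2 / (2 * n + 1) + 6 * ∑ j ∈ range n, 1 / (4 * j + 3 : K) -
    2 * ∑ j ∈ range (n + 1), 1 / (4 * j + 1 : K)

section

variable {K : Type*} [Field K]

theorem div_eq_div_of_mul_left_eq {c x y u v : K} (hc : c ≠ 0) (hx : c * x = u) (hy : c * y = v) :
    x / y = u / v := by
  rw [← hx, ← hy, mul_div_mul_left _ _ hc]

variable [CharZero K]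

theorem ne_zero_of_four_mul_eq_intCast {x : K} (z : ℤ) (h : 4 * x = z) (hz : z ≠ 0) : x ≠ 0 := by
  rintro rfl
  rw [mul_zero, eq_comm, Int.cast_eq_zero] at h
  exact hz h

theorem dixonTermLogDeriv_two_mul_add_one (n k : ℕ) :
    dixonTermLogDeriv (2 * n + 1 : K) k = ∑ j ∈ range k,
      (1 / (1 / 2 + j) + 2 / (n + 1 + j) - (1 - 2) / (1 + 1 / 2 - (n + 1) + j) -
        1 / (1 + 1 / 2 + n + j : K)) := by
  have two : (2 : K) ≠ 0 := two_ne_zero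
  rw [dixonTermLogDeriv]
  refine sum_congr rfl fun j _ => ?_
  have h₁ : 1 / (1 / 2 + j : K) = 2 / (2 * j + 1) :=
    div_eq_div_of_mul_left_eq two (by ring) (by ring)
  have h₂ : 2 / (n + 1 + j : K) = 4 / (2 * j + 1 + (2 * n + 1)) :=
    div_eq_div_of_mul_left_eq two (by ring) (by ring)
  have h₃ : (1 - 2) / (1 + 1 / 2 - (n + 1) + j : K) = -2 / (2 * j + 2 - (2 * n + 1)) :=
    div_eq_div_of_mul_left_eq two (by ring) (by ring)
  have h₄ : 1 / (1 + 1 / 2 + n + j : K) = 2 / (2 * j + 2 + (2 * n + 1)) :=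
    div_eq_div_of_mul_left_eq two (by ring) (by ring)
  rw [h₁, h₂, h₃, h₄, neg_div, sub_neg_eq_add]

theorem dixonSumLogDeriv_eq (n : ℕ) :
    dixonSumLogDeriv K n = ∑ j ∈ range n, (1 / (1 + 1 / 2 + j) +
      (1 / 2 - 2) / (1 + 1 / 2 / 2 - (n + 1) + j) -
        (1 / 2 / (1 + 1 / 2 / 2 + j) + (1 - 2) / (1 + 1 / 2 - (n + 1) + j : K))) := by
  have two : (2 : K) ≠ 0 := two_ne_zero
  have four : (4 : K) ≠ 0 := by norm_num
  have h₁ (j : ℕ) : (1 / (1 + 1 / 2 + j) : K) = 2 / (2 * (j + 1 : ℕ) + 1) :=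
    div_eq_div_of_mul_left_eq two (by ring) (by push_cast; ring)
  have h₂ (j : ℕ) : (1 / 2 / (1 + 1 / 2 / 2 + j) : K) = 2 * (1 / (4 * (j + 1 : ℕ) + 1)) := by
    rw [← mul_div_assoc]
    exact div_eq_div_of_mul_left_eq four (by ring) (by push_cast; ring)
  have reflect : ∀ j ∈ range n, (n : K) = (n - 1 - j : ℕ) + (j + 1) := fun j hj => by
    have := mem_range.1 hj
    exact_mod_cast (by omega : n = n - 1 - j + (j + 1))
  have h₃ : ∀ j ∈ range n, ((1 / 2 - 2) / (1 + 1 / 2 / 2 - (n + 1) + j) : K) =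
      6 * (1 / (4 * (n - 1 - j : ℕ) + 3)) := fun j hj => by
    rw [reflect j hj, ← mul_div_assoc]
    exact div_eq_div_of_mul_left_eq (neg_ne_zero.2 four) (by ring) (by ring)
  have h₄ : ∀ j ∈ range n, ((1 - 2) / (1 + 1 / 2 - (n + 1) + j) : K) =
      2 / (2 * (n - 1 - j : ℕ) + 1) := fun j hj => by
    rw [reflect j hj]
    exact div_eq_div_of_mul_left_eq (neg_ne_zero.2 two) (by ring) (by ring)
  rw [sum_sub_distrib, sum_add_distrib, sum_add_distrib, sum_congr rfl h₃, sum_congr rfl h₄,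
    ← mul_sum, sum_range_reflect (fun j : ℕ => 1 / (4 * j + 3 : K)),
    sum_range_reflect (fun j : ℕ => 2 / (2 * j + 1 : K)), dixonSumLogDeriv]
  simp only [h₁, h₂, ← mul_sum]
  rw [sum_range_succ' (fun j : ℕ => 1 / (4 * j + 1 : K))]
  have telescope := sum_range_succ (fun j : ℕ => 2 / (2 * j + 1 : K)) n
  rw [sum_range_succ'] at telescope
  push_cast at telescope ⊢
  linear_combination -telescope

end

theorem sum_whippleTerm_mul_logDeriv (𝕜 : Type*) [NontriviallyNormedField 𝕜] [CharZero 𝕜] (n : ℕ) :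
    ∑ k ∈ range (n + 1), whippleTerm ((2 * n + 1 : 𝕜) ^ 2) n k *
        dixonTermLogDeriv (2 * n + 1 : 𝕜) k =
      (∑ k ∈ range (n + 1), whippleTerm ((2 * n + 1 : 𝕜) ^ 2) n k) * dixonSumLogDeriv 𝕜 n := by
  simp only [dixonTermLogDeriv_two_mul_add_one, dixonSumLogDeriv_eq,
    ← dixonTerm_half_eq_whippleTerm]
  refine sum_dixonTerm_mul_logDeriv 1 2 n (fun j => ?_) (fun j => ?_) (fun j => ?_)
    (fun j => ?_) (fun j => ?_)
  · exact ne_zero_of_four_mul_eq_intCast (4 * j + 2) (by push_cast; ring) (by omega)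
  · exact ne_zero_of_four_mul_eq_intCast (4 * (n + 1 + j)) (by push_cast; ring) (by omega)
  · exact ne_zero_of_four_mul_eq_intCast (4 * j + 2 - 4 * n) (by push_cast; ring) (by omega)
  · exact ne_zero_of_four_mul_eq_intCast (4 * j + 5) (by push_cast; ring) (by omega)
  · exact ne_zero_of_four_mul_eq_intCast (4 * j + 1 - 4 * n) (by push_cast; ring) (by omega)

end WhippleDerivative

section FiniteSums

open Finset

variable (K : Type*) [Field K]

/-- The product `∏_{j < k} (2j + 1) / (2j + 2) = C(2k, k) / 4 ^ k`. -/
def centralRatio (k : ℕ) : K := ∏ j ∈ range k, (2 * j + 1 : K) / (2 * j + 2)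

/-- The product `∏_{j < k} (2j + 2) / (2j + 3) = (2k)‼ / (2k + 1)‼`. -/
def wallisRatio (k : ℕ) : K := ∏ j ∈ range k, (2 * j + 2 : K) / (2 * j + 3)

/-- The harmonic number `∑_{j ≤ k} 1 / j ^ 2` of order two. -/
def harmonicSq (k : ℕ) : K := ∑ j ∈ range k, 1 / (j + 1 : K) ^ 2

/-- The odd harmonic number `O_k^{(r)}` in an arbitrary field. -/
def oddSum (r k : ℕ) : K := ∑ j ∈ range k, 1 / (2 * j + 1 : K) ^ r

variable {K}

/-- The sum of the cubed central binomial coefficients `(C(2k, k) / 4 ^ k) ^ 3` for `k ≤ n`,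
weighted by `f k`. -/
def cubeSum (f : ℕ → K) (n : ℕ) : K := ∑ k ∈ range (n + 1), centralRatio K k ^ 3 * f k

theorem centralRatio_succ (k : ℕ) :
    centralRatio K (k + 1) = centralRatio K k * ((2 * k + 1) / (2 * k + 2)) :=
  prod_range_succ ..

theorem wallisRatio_succ (k : ℕ) :
    wallisRatio K (k + 1) = wallisRatio K k * ((2 * k + 2) / (2 * k + 3)) :=
  prod_range_succ ..

end FiniteSums

section WhippleDerivativeAtZero

open Finset

variable {𝕜 : Type*} [NontriviallyNormedField 𝕜]

theorem two_mul_add_two_ne_zero {R : Type*} [NonAssocSemiring R] [CharZero R] (j : ℕ) :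
    (2 * j + 2 : R) ≠ 0 := by
  exact_mod_cast (2 * j + 1).succ_ne_zero

theorem hasLogDerivAt_sq_sub {x : 𝕜} (hx : x ≠ 0) :
    HasLogDerivAt (fun e => x ^ 2 - e) (-1 / x ^ 2) 0 :=
  .affine (-1) (fun e => by ring) (pow_ne_zero 2 hx)

theorem hasLogDerivAt_sq_sub_div_sq_sub {x y : 𝕜} (hx : x ≠ 0) (hy : y ≠ 0) :
    HasLogDerivAt (fun e => (x ^ 2 - e) / (y ^ 2 - e)) (1 / y ^ 2 - 1 / x ^ 2) 0 := by
  convert (hasLogDerivAt_sq_sub hx).div (hasLogDerivAt_sq_sub hy) (by simpa using hy) using 1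
  ring

variable [CharZero 𝕜]

theorem eventually_forall_lt_sq_sub_ne_zero (n : ℕ) :
    ∀ᶠ e in 𝓝 (0 : 𝕜), ∀ j < n, (2 * j + 2 : 𝕜) ^ 2 - e ≠ 0 :=
  eventually_forall_lt_ne_zero (f := fun j e => (2 * j + 2 : 𝕜) ^ 2 - e) (by fun_prop)
    (fun j => by simpa using two_mul_add_two_ne_zero j) n

theorem hasLogDerivAt_whippleTerm (n k : ℕ) :
    HasLogDerivAt (fun e : 𝕜 => whippleTerm e n k) (harmonicSq 𝕜 k / 4) 0 := by
  rw [harmonicSq, sum_div]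
  refine HasLogDerivAt.prod fun j _ => ?_
  have hj := two_mul_add_two_ne_zero (R := 𝕜) j
  have denominator := (HasLogDerivAt.const (2 * j + 2 : 𝕜)).mul (hasLogDerivAt_sq_sub hj)
  convert HasLogDerivAt.div (.const _) denominator (by simpa using hj) using 1
  rw [div_div, show (j + 1 : 𝕜) ^ 2 * 4 = (2 * j + 2) ^ 2 by ring]
  ring

theorem hasDerivAt_sum_whippleTerm (n : ℕ) :
    HasDerivAt (fun e : 𝕜 => ∑ k ∈ range (n + 1), whippleTerm e n k)
      (∑ k ∈ range (n + 1), whippleTerm 0 n k * (harmonicSq 𝕜 k / 4)) 0 :=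
  HasDerivAt.fun_sum fun k _ => hasLogDerivAt_whippleTerm n k

theorem sum_whippleTerm_zero_even (m : ℕ) :
    ∑ k ∈ range (2 * m + 1), whippleTerm (0 : 𝕜) (2 * m) k = centralRatio 𝕜 m ^ 2 := by
  rw [sum_whippleTerm_even 0 m fun j _ => by simpa using two_mul_add_two_ne_zero j, centralRatio,
    ← prod_pow]
  refine prod_congr rfl fun j _ => ?_
  rw [sub_zero, sub_zero, ← div_pow]
  exact congrArg (· ^ 2) (div_eq_div_of_mul_left_eq two_ne_zero (by ring) (by ring)).symm

theorem sum_whippleTerm_mul_harmonicSq_even (m : ℕ) :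
    ∑ k ∈ range (2 * m + 1), whippleTerm (0 : 𝕜) (2 * m) k * harmonicSq 𝕜 k =
      centralRatio 𝕜 m ^ 2 * (harmonicSq 𝕜 m / 4 - oddSum 𝕜 2 m) := by
  have h₂ (j : ℕ) : (4 * j + 2 : 𝕜) ≠ 0 := by exact_mod_cast (4 * j + 1).succ_ne_zero
  have h₄ (j : ℕ) : (4 * j + 4 : 𝕜) ≠ 0 := by exact_mod_cast (4 * j + 3).succ_ne_zero
  have prod_logDeriv : HasLogDerivAt
      (fun e : 𝕜 => ∏ j ∈ range m, ((4 * j + 2) ^ 2 - e) / ((4 * j + 4) ^ 2 - e))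
      (∑ j ∈ range m, (1 / (4 * j + 4) ^ 2 - 1 / (4 * j + 2) ^ 2)) 0 :=
    .prod fun j _ => hasLogDerivAt_sq_sub_div_sq_sub (h₂ j) (h₄ j)
  have sum_eq_prod : (fun e : 𝕜 => ∑ k ∈ range (2 * m + 1), whippleTerm e (2 * m) k) =ᶠ[𝓝 0]
      fun e => ∏ j ∈ range m, ((4 * j + 2) ^ 2 - e) / ((4 * j + 4) ^ 2 - e) := by
    filter_upwards [eventually_forall_lt_sq_sub_ne_zero (2 * m)] with e he
    exact sum_whippleTerm_even e m he
  have derivs_eq := (hasDerivAt_sum_whippleTerm (2 * m)).unique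
    (HasDerivAt.congr_of_eventuallyEq prod_logDeriv sum_eq_prod)
  dsimp only at derivs_eq
  rw [← sum_eq_prod.eq_of_nhds, sum_whippleTerm_zero_even] at derivs_eq
  have logDeriv_eq : ∑ j ∈ range m, (1 / (4 * j + 4 : 𝕜) ^ 2 - 1 / (4 * j + 2) ^ 2) =
      (harmonicSq 𝕜 m / 4 - oddSum 𝕜 2 m) / 4 := by
    rw [harmonicSq, oddSum, sum_div, ← sum_sub_distrib, sum_div]
    refine sum_congr rfl fun j _ => ?_
    rw [show (4 * j + 4 : 𝕜) ^ 2 = (j + 1) ^ 2 * 16 by ring,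
      show (4 * j + 2 : 𝕜) ^ 2 = (2 * j + 1) ^ 2 * 4 by ring, ← div_div, ← div_div]
    ring
  simp only [← mul_div_assoc, ← sum_div] at derivs_eq
  rw [logDeriv_eq] at derivs_eq
  linear_combination 4 * derivs_eq

theorem sum_whippleTerm_mul_harmonicSq_odd (m : ℕ) :
    ∑ k ∈ range (2 * m + 2), whippleTerm (0 : 𝕜) (2 * m + 1) k * harmonicSq 𝕜 k =
      -wallisRatio 𝕜 m ^ 2 := by
  have h₄ (j : ℕ) : (4 * j + 4 : 𝕜) ≠ 0 := by exact_mod_cast (4 * j + 3).succ_ne_zero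
  have h₆ (j : ℕ) : (4 * j + 6 : 𝕜) ≠ 0 := by exact_mod_cast (4 * j + 5).succ_ne_zero
  have prod_logDeriv : HasLogDerivAt
      (fun e : 𝕜 => ∏ j ∈ range m, ((4 * j + 4) ^ 2 - e) / ((4 * j + 6) ^ 2 - e))
      (∑ j ∈ range m, (1 / (4 * j + 6) ^ 2 - 1 / (4 * j + 4) ^ 2)) 0 :=
    .prod fun j _ => hasLogDerivAt_sq_sub_div_sq_sub (h₄ j) (h₆ j)
  have factor_deriv : HasDerivAt (fun e : 𝕜 => -e / (4 - e)) (-1 / 4) 0 := by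
    refine ((hasDerivAt_neg' (0 : 𝕜)).fun_div ((hasDerivAt_id' 0).const_sub 4)
      (by norm_num)).congr_deriv (by norm_num)
  have sum_eq_prod : (fun e : 𝕜 => ∑ k ∈ range (2 * m + 2), whippleTerm e (2 * m + 1) k) =ᶠ[𝓝 0]
      fun e => -e / (4 - e) * ∏ j ∈ range m, ((4 * j + 4) ^ 2 - e) / ((4 * j + 6) ^ 2 - e) := by
    filter_upwards [eventually_forall_lt_sq_sub_ne_zero (2 * m + 1)] with e he
    exact sum_whippleTerm_odd e m he
  have derivs_eq := (hasDerivAt_sum_whippleTerm (2 * m + 1)).unique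
    ((factor_deriv.fun_mul prod_logDeriv).congr_of_eventuallyEq sum_eq_prod)
  have prod_eq : ∏ j ∈ range m, ((4 * j + 4 : 𝕜) ^ 2 - 0) / ((4 * j + 6) ^ 2 - 0) =
      wallisRatio 𝕜 m ^ 2 := by
    rw [wallisRatio, ← prod_pow]
    refine prod_congr rfl fun j _ => ?_
    rw [sub_zero, sub_zero, ← div_pow]
    exact congrArg (· ^ 2) (div_eq_div_of_mul_left_eq two_ne_zero (by ring) (by ring)).symm
  rw [prod_eq, neg_zero, zero_div, zero_mul, add_zero] at derivs_eq
  simp only [← mul_div_assoc, ← sum_div] at derivs_eq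
  linear_combination 4 * derivs_eq

end WhippleDerivativeAtZero

section Residues

open Finset

variable {p : ℕ} [Fact p.Prime]

theorem natCast_zmod_ne_zero {k : ℕ} (hk : k ≠ 0) (hkp : k < p) : (k : ZMod p) ≠ 0 := by
  rw [Ne, ZMod.natCast_eq_zero_iff]
  exact Nat.not_dvd_of_pos_of_lt (Nat.pos_of_ne_zero hk) hkp

theorem ofNat_zmod_ne_zero {k : ℕ} [k.AtLeastTwo] (hkp : OfNat.ofNat k < p) :
    (OfNat.ofNat k : ZMod p) ≠ 0 :=
  natCast_zmod_ne_zero (NeZero.ne k) hkp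

theorem two_mul_add_one_zmod_ne_zero {j : ℕ} (hj : 2 * j + 1 < p) : (2 * j + 1 : ZMod p) ≠ 0 := by
  exact_mod_cast natCast_zmod_ne_zero (2 * j).succ_ne_zero hj

theorem two_mul_add_two_zmod_ne_zero {j : ℕ} (hj : 2 * j + 2 < p) : (2 * j + 2 : ZMod p) ≠ 0 := by
  exact_mod_cast natCast_zmod_ne_zero (2 * j + 1).succ_ne_zero hj

theorem hasResidue_two_mul_add_one (j : ℕ) : HasResidue (2 * j + 1 : ℚ_[p]) (2 * j + 1) := by
  exact_mod_cast HasResidue.natCast (2 * j + 1)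

theorem hasResidue_two_mul_add_two (j : ℕ) : HasResidue (2 * j + 2 : ℚ_[p]) (2 * j + 2) := by
  exact_mod_cast HasResidue.natCast (2 * j + 2)

theorem hasResidue_centralRatio {k : ℕ} (hk : 2 * k < p) :
    HasResidue (centralRatio ℚ_[p] k) (centralRatio (ZMod p) k) := by
  refine .prod fun j hj => (hasResidue_two_mul_add_one j).div (hasResidue_two_mul_add_two j) ?_
  exact two_mul_add_two_zmod_ne_zero (by grind)

theorem hasResidue_wallisRatio {k : ℕ} (hk : 2 * k + 1 < p) :
    HasResidue (wallisRatio ℚ_[p] k) (wallisRatio (ZMod p) k) := by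
  refine .prod fun j hj => (hasResidue_two_mul_add_two j).div ?_ ?_
  · exact_mod_cast HasResidue.natCast (2 * j + 3)
  · exact_mod_cast natCast_zmod_ne_zero (2 * j + 2).succ_ne_zero (by grind)

theorem hasResidue_harmonicSq {k : ℕ} (hk : k < p) :
    HasResidue (harmonicSq ℚ_[p] k) (harmonicSq (ZMod p) k) := by
  refine .sum fun j hj => HasResidue.one.div (((HasResidue.natCast j).add .one).pow 2) ?_
  exact pow_ne_zero 2 (by exact_mod_cast natCast_zmod_ne_zero j.succ_ne_zero (by grind))

theorem hasResidue_oddSum (r : ℕ) {k : ℕ} (hk : 2 * k ≤ p) :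
    HasResidue (oddSum ℚ_[p] r k) (oddSum (ZMod p) r k) := by
  refine .sum fun j hj => HasResidue.one.div ((hasResidue_two_mul_add_one j).pow r) ?_
  exact pow_ne_zero r (two_mul_add_one_zmod_ne_zero (by grind))

theorem hasResidue_cubeSum {f : ℕ → ℚ_[p]} {g : ℕ → ZMod p} {n : ℕ} (hn : 2 * n < p)
    (h : ∀ k ≤ n, HasResidue (f k) (g k)) : HasResidue (cubeSum f n) (cubeSum g n) :=
  .sum fun k hk => ((hasResidue_centralRatio (by grind)).pow 3).mul (h k (by grind))

variable {n : ℕ}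

theorem two_mul_half_zmod (h : p = 2 * n + 1) : (2 * n : ZMod p) = -1 := by
  have : ((2 * n + 1 : ℕ) : ZMod p) = 0 := by rw [← h, ZMod.natCast_self]
  push_cast at this
  linear_combination this

theorem hasResidue_whippleTerm {e : ℚ_[p]} (h : p = 2 * n + 1) (he : HasResidue e 0) {k : ℕ}
    (hk : k ≤ n) : HasResidue (whippleTerm e n k) (centralRatio (ZMod p) k ^ 3) := by
  rw [centralRatio, ← prod_pow]
  refine .prod fun j hj => ?_
  have hodd := hasResidue_two_mul_add_one (p := p) j
  have heven := hasResidue_two_mul_add_two (p := p) j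
  have hj0 : (2 * j + 2 : ZMod p) ≠ 0 := two_mul_add_two_zmod_ne_zero (by grind)
  convert (hodd.mul ((hodd.pow 2).sub ((hasResidue_two_mul_add_one n).pow 2))).div
    (heven.mul ((heven.pow 2).sub he)) (by simpa using hj0) using 1
  rw [two_mul_half_zmod h, neg_add_cancel, zero_pow two_ne_zero, sub_zero, sub_zero, ← pow_succ',
    ← pow_succ', div_pow]

theorem centralRatio_zmod (h : p = 2 * n + 1) {k : ℕ} (hk : k ≤ n) :
    centralRatio (ZMod p) k = (-1) ^ k * n.choose k := by
  induction k with
  | zero => simp [centralRatio]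
  | succ k ih =>
    have hk0 : (2 * k + 2 : ZMod p) ≠ 0 := two_mul_add_two_zmod_ne_zero (by omega)
    have absorption := congrArg (Nat.cast (R := ZMod p)) (n.choose_succ_right_eq k)
    push_cast [Nat.cast_sub (Nat.le_of_succ_le hk)] at absorption
    rw [centralRatio_succ, ih (by omega), mul_div_assoc',
      div_eq_iff hk0]
    linear_combination 2 * (-1) ^ k * absorption +
      (-1) ^ k * (n.choose k : ZMod p) * two_mul_half_zmod h

theorem centralRatio_zmod_reflect (h : p = 2 * n + 1) {k : ℕ} (hk : k ≤ n) :
    centralRatio (ZMod p) (n - k) = (-1) ^ n * centralRatio (ZMod p) k := by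
  obtain ⟨j, rfl⟩ := Nat.exists_eq_add_of_le hk
  rw [Nat.add_sub_cancel_left, centralRatio_zmod h (by omega), centralRatio_zmod h hk,
    Nat.choose_symm_add, pow_add, mul_right_comm, ← mul_assoc, ← pow_add, ← two_mul, pow_mul,
    neg_one_sq, one_pow, one_mul, mul_comm]

theorem four_mul_oddSum_two_zmod (h : p = 2 * n + 1) {k : ℕ} (hk : k ≤ n) :
    4 * oddSum (ZMod p) 2 k = harmonicSq (ZMod p) n - harmonicSq (ZMod p) (n - k) := by
  induction k with
  | zero => simp [oddSum]
  | succ k ih =>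
    obtain ⟨l, rfl⟩ := Nat.exists_eq_add_of_le hk
    have half := two_mul_half_zmod h
    push_cast at half
    have hl : 4 * (1 / (2 * k + 1 : ZMod p) ^ 2) = 1 / (l + 1 : ZMod p) ^ 2 := by
      have hl0 : (l + 1 : ZMod p) ≠ 0 := by
        exact_mod_cast natCast_zmod_ne_zero l.succ_ne_zero (by omega)
      rw [show (2 * k + 1 : ZMod p) = -2 * (l + 1) by linear_combination half]
      have h2 : (2 : ZMod p) ≠ 0 := ofNat_zmod_ne_zero (by omega)
      field_simp
      norm_num
    specialize ih (by omega)
    rw [show k + 1 + l - k = l + 1 by omega, harmonicSq, harmonicSq, sum_range_succ _ l] at ih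
    rw [Nat.add_sub_cancel_left, oddSum, sum_range_succ, ← oddSum, harmonicSq, harmonicSq]
    linear_combination ih + hl

theorem four_mul_one_div_two_mul_add_two_sq {K : Type*} [Field K] (h2 : (2 : K) ≠ 0) (n : ℕ) :
    4 * (1 / (2 * n + 2 : K) ^ 2) = 1 / (n + 1 : K) ^ 2 := by
  rw [show (2 * n + 2 : K) = 2 * (n + 1) by ring, mul_pow, one_div, mul_inv, ← mul_assoc,
    show (4 : K) = 2 ^ 2 by norm_num, mul_inv_cancel₀ (pow_ne_zero 2 h2), one_mul, one_div]

theorem four_mul_harmonicSq_two_mul {K : Type*} [Field K] (h2 : (2 : K) ≠ 0) (n : ℕ) :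
    4 * harmonicSq K (2 * n) = 4 * oddSum K 2 n + harmonicSq K n := by
  induction n with
  | zero => simp [harmonicSq, oddSum]
  | succ n ih =>
    rw [harmonicSq, harmonicSq, oddSum, mul_add, sum_range_succ, sum_range_succ, sum_range_succ,
      sum_range_succ, ← harmonicSq, ← harmonicSq, ← oddSum]
    push_cast
    linear_combination ih + four_mul_one_div_two_mul_add_two_sq h2 n

theorem zmod_pow_sub_three (hp : 3 < p) (x : ZMod p) : x ^ (p - 3) = 1 / x ^ 2 := by
  rcases eq_or_ne x 0 with rfl | hx
  · simp [show p - 3 ≠ 0 by omega]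
  · rw [eq_div_iff (pow_ne_zero 2 hx), ← pow_add, show p - 3 + 2 = p - 1 by omega,
      ZMod.pow_card_sub_one_eq_one hx]

theorem sum_zmod_eq_sum_range {M : Type*} [AddCommMonoid M] (f : ZMod p → M) :
    ∑ x, f x = ∑ k ∈ range p, f k :=
  .symm <| sum_bij' (fun k _ => k) (fun x _ => x.val) (by simp)
    (fun x _ => mem_range.2 x.val_lt) (fun _ hk => ZMod.val_cast_of_lt (mem_range.1 hk)) (by simp)
    (by simp)

theorem harmonicSq_two_mul_zmod (h : p = 2 * n + 1) (hp : 3 < p) :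
    harmonicSq (ZMod p) (2 * n) = 0 := by
  have sum_powers := FiniteField.sum_pow_lt_card_sub_one (ZMod p) (p - 3)
    (by rw [ZMod.card]; omega)
  simp only [zmod_pow_sub_three hp] at sum_powers
  rw [sum_zmod_eq_sum_range, show range p = range (2 * n + 1) by rw [h],
    sum_range_succ'] at sum_powers
  simpa [harmonicSq] using sum_powers

theorem harmonicSq_half_zmod (h : p = 2 * n + 1) (hp : 3 < p) : harmonicSq (ZMod p) n = 0 := by
  have h2 : (2 : ZMod p) ≠ 0 := ofNat_zmod_ne_zero (by omega)
  have total := four_mul_harmonicSq_two_mul h2 n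
  rw [four_mul_oddSum_two_zmod h le_rfl, harmonicSq_two_mul_zmod h hp, Nat.sub_self,
    show harmonicSq (ZMod p) 0 = 0 from sum_range_zero _] at total
  have double : 2 * harmonicSq (ZMod p) n = 0 := by linear_combination -total
  exact (mul_eq_zero.1 double).resolve_left h2

theorem four_mul_cubeSum_oddSum_two_zmod (h : p = 2 * n + 1) (hp : 3 < p) :
    4 * cubeSum (oddSum (ZMod p) 2) n = -(-1) ^ n * cubeSum (harmonicSq (ZMod p)) n := by
  rw [cubeSum, cubeSum, ← sum_flip (fun k => _ * harmonicSq (ZMod p) k), mul_sum, mul_sum]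
  refine sum_congr rfl fun k hk => ?_
  have hk : k ≤ n := by grind
  have sign : ((-1 : ZMod p) ^ n) ^ 4 = 1 := by
    rw [pow_right_comm, Even.neg_one_pow ⟨2, rfl⟩, one_pow]
  rw [centralRatio_zmod_reflect h hk]
  linear_combination centralRatio (ZMod p) k ^ 3 *
    (four_mul_oddSum_two_zmod h hk + harmonicSq_half_zmod h hp) +
    centralRatio (ZMod p) k ^ 3 * harmonicSq (ZMod p) (n - k) * sign

theorem hasResidue_sum_whippleTerm_mul {e : ℚ_[p]} (h : p = 2 * n + 1) (he : HasResidue e 0)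
    {f : ℕ → ℚ_[p]} {g : ℕ → ZMod p} (hf : ∀ k ≤ n, HasResidue (f k) (g k)) :
    HasResidue (∑ k ∈ range (n + 1), whippleTerm e n k * f k) (cubeSum g n) :=
  .sum fun k hk => (hasResidue_whippleTerm h he (by grind)).mul (hf k (by grind))

theorem factorial_mul_factorial_zmod {a b : ℕ} (h : p = a + b + 1) :
    (a.factorial * b.factorial : ZMod p) = (-1) ^ (b + 1) := by
  have wilson := ZMod.wilsons_lemma p
  rw [← Nat.factorial_mul_descFactorial (show b ≤ p - 1 by omega), Nat.cast_mul,
    ZMod.cast_descFactorial (by omega), show p - 1 - b = a by omega] at wilson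
  have sign : ((-1 : ZMod p) ^ b) ^ 2 = 1 := by
    rw [pow_right_comm, neg_one_sq, one_pow]
  linear_combination (-1) ^ b * wilson - (a.factorial * b.factorial : ZMod p) * sign

theorem two_mul_cubeSum_harmonicSq_zmod_even {m : ℕ} (h : p = 2 * (2 * m) + 1) (hp : 3 < p) :
    2 * cubeSum (harmonicSq (ZMod p)) (2 * m) =
      centralRatio (ZMod p) m ^ 2 * harmonicSq (ZMod p) m := by
  have h4 : (4 : ZMod p) ≠ 0 := ofNat_zmod_ne_zero (by omega)
  have residue := hasResidue_sum_whippleTerm_mul h .zero fun k hk =>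
    hasResidue_harmonicSq (p := p) (k := k) (by omega)
  rw [sum_whippleTerm_mul_harmonicSq_even] at residue
  have eq := residue.unique (((hasResidue_centralRatio (by omega)).pow 2).mul
    (((hasResidue_harmonicSq (by omega)).div (.ofNat 4) h4).sub (hasResidue_oddSum 2 (by omega))))
  have reflect := four_mul_oddSum_two_zmod h (k := m) (by omega)
  rw [harmonicSq_half_zmod h hp, show 2 * m - m = m by omega] at reflect
  rw [eq]
  apply mul_left_cancel₀ h4
  field_simp
  linear_combination -2 * centralRatio (ZMod p) m ^ 2 * reflect

theorem centralRatio_mul_wallisRatio_zmod {m : ℕ} (hm : 2 * m + 1 < p) :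
    (2 * m + 1) * (centralRatio (ZMod p) m * wallisRatio (ZMod p) m) = 1 := by
  induction m with
  | zero => simp [centralRatio, wallisRatio]
  | succ m ih =>
    have hm2 : (2 * m + 2 : ZMod p) ≠ 0 := two_mul_add_two_zmod_ne_zero (by omega)
    have hm3 : (2 * m + 3 : ZMod p) ≠ 0 := by
      exact_mod_cast natCast_zmod_ne_zero (2 * m + 2).succ_ne_zero hm
    refine Eq.trans ?_ (ih (by omega))
    rw [centralRatio_succ, wallisRatio_succ, Nat.cast_succ,
      show (2 * (m + 1) + 1 : ZMod p) = 2 * m + 3 by ring, mul_mul_mul_comm,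
      div_mul_div_cancel₀ hm2]
    field_simp

theorem four_mul_wallisRatio_sq_zmod {m : ℕ} (h : p = 2 * (2 * m + 1) + 1) :
    4 * wallisRatio (ZMod p) m ^ 2 = (m.factorial : ZMod p) ^ 4 := by
  have binomial := congrArg (Nat.cast (R := ZMod p))
    (Nat.choose_mul_factorial_mul_factorial (show m ≤ 2 * m + 1 by omega))
  rw [show 2 * m + 1 - m = m + 1 by omega, Nat.factorial_succ] at binomial
  have wilson := factorial_mul_factorial_zmod (a := 2 * m + 1) (b := 2 * m + 1) (by omega : p = _)
  rw [Even.neg_one_pow ⟨m + 1, by ring⟩] at wilson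
  have ratio := centralRatio_mul_wallisRatio_zmod (p := p) (m := m) (by omega)
  rw [centralRatio_zmod h (by omega)] at ratio
  have half := two_mul_half_zmod h
  have sign : ((-1 : ZMod p) ^ m) ^ 2 = 1 := by
    rw [pow_right_comm, neg_one_sq, one_pow]
  push_cast at binomial half
  set c : ZMod p := ((2 * m + 1).choose m : ZMod p)
  have wallis : (-1) ^ m * (c * wallisRatio (ZMod p) m) = -2 := by
    linear_combination (-1) ^ m * c * wallisRatio (ZMod p) m * half - 2 * ratio
  have hc : c ≠ 0 := fun hc => by simp [hc] at ratio
  have hfactorial : c * (m.factorial : ZMod p) ^ 2 = 4 * (2 * m + 1).factorial := by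
    linear_combination 4 * binomial - c * (m.factorial : ZMod p) ^ 2 * half
  apply mul_left_cancel₀ (pow_ne_zero 2 hc)
  linear_combination 4 * ((-1) ^ m * (c * wallisRatio (ZMod p) m) - 2) * wallis
    - 4 * (c * wallisRatio (ZMod p) m) ^ 2 * sign
    - (c * (m.factorial : ZMod p) ^ 2 + 4 * (2 * m + 1).factorial) * hfactorial - 16 * wilson

theorem four_mul_cubeSum_harmonicSq_zmod_odd {m : ℕ} (h : p = 2 * (2 * m + 1) + 1) :
    4 * cubeSum (harmonicSq (ZMod p)) (2 * m + 1) = -(m.factorial : ZMod p) ^ 4 := by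
  have residue := hasResidue_sum_whippleTerm_mul h .zero fun k hk =>
    hasResidue_harmonicSq (p := p) (k := k) (by omega)
  rw [sum_whippleTerm_mul_harmonicSq_odd] at residue
  rw [residue.unique ((hasResidue_wallisRatio (by omega)).pow 2).neg, mul_neg,
    four_mul_wallisRatio_sq_zmod h]

end Residues

section DixonSumModPrime

open Finset

variable {p : ℕ} [Fact p.Prime]

theorem hasResidue_inv_add_inv_div_prime {z : ℚ_[p]} {w : ZMod p} (hz : HasResidue z w)
    (hw : w ≠ 0) :
    HasResidue ((1 / (p + z : ℚ_[p]) + 1 / (p - z : ℚ_[p])) / (p : ℚ_[p])) (-2 / w ^ 2) := by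
  have hadd : HasResidue (p + z : ℚ_[p]) w := by simpa using HasResidue.prime.add hz
  have hsub : HasResidue (p - z : ℚ_[p]) (-w) := by simpa using HasResidue.prime.sub hz
  have hw' : w * -w ≠ 0 := mul_ne_zero hw (neg_ne_zero.2 hw)
  have hadd0 : (p + z : ℚ_[p]) ≠ 0 := norm_ne_zero_iff.1 (by simp [hadd.norm_eq_one hw])
  have hsub0 : (p - z : ℚ_[p]) ≠ 0 :=
    norm_ne_zero_iff.1 (by simp [hsub.norm_eq_one (neg_ne_zero.2 hw)])
  have two : HasResidue (2 : ℚ_[p]) 2 := .ofNat 2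
  convert two.div (hadd.mul hsub) hw' using 1
  · field [NeZero.ne (p : ℚ_[p])]
  · rw [mul_neg, ← sq, div_neg, neg_div]

theorem sum_range_two_mul {M : Type*} [AddCommMonoid M] {f g : ℕ → M} {m : ℕ}
    (h : ∀ i j, i + j + 1 = m → f (m + i) + f j = g i) :
    ∑ j ∈ range (2 * m), f j = ∑ i ∈ range m, g i := by
  rw [two_mul, sum_range_add, ← sum_range_reflect, add_comm, ← sum_add_distrib]
  exact sum_congr rfl fun i hi => h i _ (by grind)

theorem sum_range_two_mul_add_one {M : Type*} [AddCommMonoid M] {f g : ℕ → M} {m : ℕ}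
    (h : ∀ i j, i + j + 1 = m → f (m + 1 + i) + f j = g i) :
    ∑ j ∈ range (2 * m + 1), f j = f m + ∑ i ∈ range m, g i := by
  rw [two_mul, add_right_comm, sum_range_add, sum_range_succ, ← sum_range_reflect, add_comm _ (f m),
    add_assoc, add_comm (∑ _ ∈ _, _), ← sum_add_distrib]
  exact congrArg _ (sum_congr rfl fun i hi => h i _ (by grind))

theorem hasResidue_sum_inv_div_prime_even {m c : ℕ} (hp : 2 < p) (hm : 2 * m ≤ p)
    (h : 4 * m + c = p + 2) :
    HasResidue ((∑ j ∈ range (2 * m), 1 / (4 * j + c : ℚ_[p])) / (p : ℚ_[p]))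
      (-oddSum (ZMod p) 2 m / 2) := by
  have h2 : (2 : ZMod p) ≠ 0 := ofNat_zmod_ne_zero hp
  have hc : (4 * m + c : ℚ_[p]) = p + 2 := by exact_mod_cast h
  rw [sum_range_two_mul (g := fun i => 1 / (p + 2 * (2 * i + 1) : ℚ_[p]) +
    1 / (p - 2 * (2 * i + 1) : ℚ_[p])), sum_div, oddSum, neg_div, sum_div, ← sum_neg_distrib]
  · refine .sum fun i hi => ?_
    have hi0 : (2 * i + 1 : ZMod p) ≠ 0 := two_mul_add_one_zmod_ne_zero (by grind)
    have two : HasResidue (2 : ℚ_[p]) 2 := .ofNat 2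
    convert hasResidue_inv_add_inv_div_prime (two.mul (hasResidue_two_mul_add_one i))
      (mul_ne_zero h2 hi0) using 1
    field
  · rintro i j rfl
    push_cast at hc ⊢
    congr 2 <;> linear_combination hc

theorem hasResidue_sum_inv_div_prime_odd {m c : ℕ} (hp : 2 < p) (hm : m < p)
    (h : 4 * m + c = p) :
    HasResidue ((∑ j ∈ range (2 * m + 1), 1 / (4 * j + c : ℚ_[p]) - 1 / (p : ℚ_[p])) / (p : ℚ_[p]))
      (-harmonicSq (ZMod p) m / 8) := by
  have h2 : (2 : ZMod p) ≠ 0 := ofNat_zmod_ne_zero hp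
  have h8 : (8 : ZMod p) = 2 ^ 3 := by norm_num
  have hc : (4 * m + c : ℚ_[p]) = p := by exact_mod_cast h
  rw [sum_range_two_mul_add_one (g := fun i => 1 / (p + 2 ^ 2 * (i + 1) : ℚ_[p]) +
    1 / (p - 2 ^ 2 * (i + 1) : ℚ_[p])), hc, add_sub_cancel_left, sum_div, harmonicSq, neg_div,
    sum_div, ← sum_neg_distrib, h8]
  · refine .sum fun i hi => ?_
    have hi0 : (i + 1 : ZMod p) ≠ 0 := by
      exact_mod_cast natCast_zmod_ne_zero i.succ_ne_zero (by grind)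
    have two : HasResidue (2 : ℚ_[p]) 2 := .ofNat 2
    convert hasResidue_inv_add_inv_div_prime ((two.pow 2).mul ((HasResidue.natCast i).add .one))
      (mul_ne_zero (pow_ne_zero 2 h2) hi0) using 1
    field
  · rintro i j rfl
    push_cast at hc ⊢
    congr 2 <;> linear_combination hc

theorem hasResidue_dixonSumLogDeriv_div_prime {m : ℕ} (h : p = 2 * (2 * m) + 1) (hp : 3 < p) :
    HasResidue (dixonSumLogDeriv ℚ_[p] (2 * m) / (p : ℚ_[p])) (harmonicSq (ZMod p) m) := by
  have h8 : (8 : ZMod p) ≠ 0 := by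
    rw [show (8 : ZMod p) = 2 ^ 3 by norm_num]
    exact pow_ne_zero 3 (ofNat_zmod_ne_zero (by omega))
  have h3 := hasResidue_sum_inv_div_prime_even (p := p) (m := m) (c := 3) (by omega) (by omega)
    (by omega)
  have h1 := hasResidue_sum_inv_div_prime_odd (p := p) (m := m) (c := 1) (by omega) (by omega)
    (by omega)
  have hn : (2 * (2 * m : ℕ) + 1 : ℚ_[p]) = p := by exact_mod_cast h.symm
  convert ((HasResidue.ofNat 6).mul h3).sub ((HasResidue.ofNat 2).mul h1) using 1
  · rw [dixonSumLogDeriv, hn]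
    push_cast
    ring
  · have reflect := four_mul_oddSum_two_zmod h (k := m) (by omega)
    rw [harmonicSq_half_zmod h hp, show 2 * m - m = m by omega] at reflect
    have h2 : (2 : ZMod p) ≠ 0 := ofNat_zmod_ne_zero (by omega)
    field_simp
    linear_combination 12 * reflect

theorem hasResidue_prime_mul_dixonSumLogDeriv {m : ℕ} (h : p = 2 * (2 * m + 1) + 1) :
    HasResidue ((p : ℚ_[p]) * dixonSumLogDeriv ℚ_[p] (2 * m + 1)) 8 := by
  have h3 := hasResidue_sum_inv_div_prime_odd (p := p) (m := m) (c := 3) (by omega) (by omega)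
    (by omega)
  have h1 := hasResidue_sum_inv_div_prime_even (p := p) (m := m + 1) (c := 1) (by omega) (by omega)
    (by omega)
  have hn : (2 * (2 * m + 1 : ℕ) + 1 : ℚ_[p]) = p := by exact_mod_cast h.symm
  have hp : (p : ℚ_[p]) ≠ 0 := NeZero.ne _
  have eight : HasResidue (8 : ℚ_[p]) 8 := .ofNat 8
  convert eight.add ((HasResidue.prime.pow 2).mul
    (((HasResidue.ofNat 6).mul h3).sub ((HasResidue.ofNat 2).mul h1))) using 1
  · rw [dixonSumLogDeriv, hn]
    rw [mul_add_one 2 m]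
    push_cast
    field_simp
    ring
  · simp

end DixonSumModPrime

section WhippleSumModPrime

open Finset

variable {p : ℕ} [Fact p.Prime]

theorem hasResidue_sq_sub {x e : ℚ_[p]} {y : ZMod p} (hx : HasResidue x y) (he : HasResidue e 0) :
    HasResidue (x ^ 2 - e) (y ^ 2) := by
  simpa using (hx.pow 2).sub he

theorem two_mul_add_two_sq_sub_ne_zero {e : ℚ_[p]} (he : HasResidue e 0) {j : ℕ}
    (hj : 2 * j + 2 < p) : (2 * j + 2 : ℚ_[p]) ^ 2 - e ≠ 0 := by
  have hres := hasResidue_sq_sub (hasResidue_two_mul_add_two j) he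
  have hnorm := hres.norm_eq_one (pow_ne_zero 2 (two_mul_add_two_zmod_ne_zero hj))
  exact norm_ne_zero_iff.1 (by simp [hnorm])

theorem hasResidue_sum_whippleTerm_even {e : ℚ_[p]} {m : ℕ} (h : p = 2 * (2 * m) + 1)
    (he : HasResidue e 0) :
    HasResidue (∑ k ∈ range (2 * m + 1), whippleTerm e (2 * m) k)
      (centralRatio (ZMod p) m ^ 2) := by
  have h2 : (2 : ZMod p) ≠ 0 := ofNat_zmod_ne_zero (by have := (Fact.out : p.Prime).two_le; omega)
  rw [sum_whippleTerm_even e m fun j hj => two_mul_add_two_sq_sub_ne_zero he (by omega),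
    centralRatio, ← prod_pow]
  refine .prod fun j hj => ?_
  have hj0 : (2 * j + 2 : ZMod p) ≠ 0 := two_mul_add_two_zmod_ne_zero (by grind)
  have two : HasResidue (2 : ℚ_[p]) 2 := .ofNat 2
  convert (hasResidue_sq_sub (two.mul (hasResidue_two_mul_add_one j)) he).div
    (hasResidue_sq_sub (two.mul (hasResidue_two_mul_add_two j)) he)
    (pow_ne_zero 2 (mul_ne_zero h2 hj0)) using 1
  · ring
  · field

theorem hasResidue_sum_whippleTerm_odd_div {e : ℚ_[p]} {m : ℕ} (h : p = 2 * (2 * m + 1) + 1)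
    (he : HasResidue e 0) (he0 : e ≠ 0) :
    HasResidue ((∑ k ∈ range (2 * m + 1 + 1), whippleTerm e (2 * m + 1) k) / e)
      (-(m.factorial : ZMod p) ^ 4 / 16) := by
  have h2 : (2 : ZMod p) ≠ 0 := ofNat_zmod_ne_zero (by omega)
  have two : HasResidue (2 : ℚ_[p]) 2 := .ofNat 2
  have hprod : HasResidue
      (∏ j ∈ range m, ((4 * j + 4 : ℚ_[p]) ^ 2 - e) / ((4 * j + 6 : ℚ_[p]) ^ 2 - e))
      (wallisRatio (ZMod p) m ^ 2) := by
    rw [wallisRatio, ← prod_pow]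
    refine .prod fun j hj => ?_
    have hj0 : (2 * j + 3 : ZMod p) ≠ 0 := by
      exact_mod_cast natCast_zmod_ne_zero (2 * j + 2).succ_ne_zero (by grind)
    have hj3 : HasResidue (2 * j + 3 : ℚ_[p]) (2 * j + 3) := by
      exact_mod_cast HasResidue.natCast (2 * j + 3)
    convert (hasResidue_sq_sub (two.mul (hasResidue_two_mul_add_two j)) he).div
      (hasResidue_sq_sub (two.mul hj3) he) (pow_ne_zero 2 (mul_ne_zero h2 hj0)) using 1
    · ring
    · field
  have h4 := hasResidue_sq_sub two he
  have h40 : (2 : ℚ_[p]) ^ 2 - e ≠ 0 :=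
    norm_ne_zero_iff.1 (by simp [h4.norm_eq_one (pow_ne_zero 2 h2)])
  rw [show 2 * m + 1 + 1 = 2 * m + 2 from rfl,
    sum_whippleTerm_odd e m fun j hj => two_mul_add_two_sq_sub_ne_zero he (by omega),
    show (4 : ℚ_[p]) - e = 2 ^ 2 - e by norm_num]
  convert (HasResidue.one.div h4 (pow_ne_zero 2 h2)).neg.mul hprod using 1
  · field
  · rw [← four_mul_wallisRatio_sq_zmod h, show (16 : ZMod p) = 2 ^ 2 * 2 ^ 2 by norm_num,
      show (4 : ZMod p) = 2 ^ 2 by norm_num]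
    field

theorem hasResidue_prime_sq : HasResidue ((p : ℚ_[p]) ^ 2) 0 := by
  simpa using (HasResidue.prime (p := p)).pow 2

theorem hasResidue_sum_mul_dixonSumLogDeriv_even {m : ℕ} (h : p = 2 * (2 * m) + 1) (hp : 3 < p) :
    HasResidue ((∑ k ∈ range (2 * m + 1), whippleTerm ((p : ℚ_[p]) ^ 2) (2 * m) k) *
        dixonSumLogDeriv ℚ_[p] (2 * m) / (p : ℚ_[p]))
      (centralRatio (ZMod p) m ^ 2 * harmonicSq (ZMod p) m) := by
  rw [mul_div_assoc]
  exact (hasResidue_sum_whippleTerm_even h hasResidue_prime_sq).mul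
    (hasResidue_dixonSumLogDeriv_div_prime h hp)

theorem hasResidue_sum_mul_dixonSumLogDeriv_odd {m : ℕ} (h : p = 2 * (2 * m + 1) + 1) :
    HasResidue ((∑ k ∈ range (2 * m + 1 + 1), whippleTerm ((p : ℚ_[p]) ^ 2) (2 * m + 1) k) *
        dixonSumLogDeriv ℚ_[p] (2 * m + 1) / (p : ℚ_[p]))
      (-(m.factorial : ZMod p) ^ 4 / 2) := by
  have h2 : (2 : ZMod p) ≠ 0 := ofNat_zmod_ne_zero (by omega)
  have hp0 : (p : ℚ_[p]) ≠ 0 := NeZero.ne _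
  convert (hasResidue_sum_whippleTerm_odd_div h hasResidue_prime_sq
    (pow_ne_zero 2 hp0)).mul (hasResidue_prime_mul_dixonSumLogDeriv h) using 1
  · field
  · rw [show (8 : ZMod p) = 2 ^ 3 by norm_num, show (16 : ZMod p) = 2 ^ 4 by norm_num]
    field

end WhippleSumModPrime

section DixonSumModPrimeSq

open Finset

variable {p : ℕ} [Fact p.Prime]

theorem padicCongr_whippleTerm {k n : ℕ} (h : p = 2 * n + 1) (hk : k ≤ n) :
    PadicCongr p 2 (whippleTerm ((p : ℚ_[p]) ^ 2) n k) (centralRatio ℚ_[p] k ^ 3) := by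
  have hn : (2 * n + 1 : ℚ_[p]) = p := by exact_mod_cast h.symm
  simp only [whippleTerm, hn, centralRatio, ← prod_pow, div_pow]
  have cube {x : ℚ_[p]} (hx : ‖x‖ ≤ 1) :
      PadicCongr p 2 (x * (x ^ 2 - (p : ℚ_[p]) ^ 2)) (x ^ 3) := by
    rw [pow_succ' x 2]
    exact .mul_left hx ⟨-1, by simp⟩
  have perturbed {x : ℚ_[p]} {y : ZMod p} (hx : HasResidue x y) :
      HasResidue (x * (x ^ 2 - (p : ℚ_[p]) ^ 2)) (y ^ 3) := by
    rw [pow_succ' y 2]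
    exact hx.mul (hasResidue_sq_sub hx hasResidue_prime_sq)
  have hodd (j : ℕ) := hasResidue_two_mul_add_one (p := p) j
  have heven (j : ℕ) := hasResidue_two_mul_add_two (p := p) j
  have hj0 {j : ℕ} (hj : j ∈ range k) : (2 * j + 2 : ZMod p) ^ 3 ≠ 0 :=
    pow_ne_zero 3 (two_mul_add_two_zmod_ne_zero (by grind))
  refine .prod (fun j hj => ?_) (fun j hj => ?_) fun j hj => ?_
  · exact .div (cube (hodd j).norm_le_one) (cube (heven j).norm_le_one)
      (perturbed (hodd j)).norm_le_one ((perturbed (heven j)).norm_eq_one (hj0 hj))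
      (((heven j).pow 3).norm_eq_one (hj0 hj))
  · exact ((perturbed (hodd j)).div (perturbed (heven j)) (hj0 hj)).norm_le_one
  · exact (((hodd j).pow 3).div ((heven j).pow 3) (hj0 hj)).norm_le_one

theorem padicCongr_two_div_add_four_div {j : ℕ} (hj : 2 * j + 2 < p) :
    PadicCongr p 2
      (2 / (2 * j + 1 : ℚ_[p]) + 4 / (2 * j + 1 + p : ℚ_[p]) + 2 / (2 * j + 2 - p : ℚ_[p]) -
        2 / (2 * j + 2 + p : ℚ_[p]))
      (6 * (1 / (2 * j + 1 : ℚ_[p]) ^ 1) +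
        p * (1 / (j + 1 : ℚ_[p]) ^ 2 - 4 * (1 / (2 * j + 1 : ℚ_[p]) ^ 2))) := by
  have hodd : (2 * j + 1 : ℚ_[p]) ≠ 0 := by exact_mod_cast (2 * j).succ_ne_zero
  have heven : (j + 1 : ℚ_[p]) ≠ 0 := by exact_mod_cast j.succ_ne_zero
  have inv_odd := padicCongr_inv_add_prime_mul (p := p) (z := 1)
    ((hasResidue_two_mul_add_one j).norm_eq_one (two_mul_add_one_zmod_ne_zero (by omega)))
    norm_one.le
  have inv_even {z : ℚ_[p]} (hz : ‖z‖ ≤ 1) := padicCongr_inv_add_prime_mul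
    ((hasResidue_two_mul_add_two j).norm_eq_one (two_mul_add_two_zmod_ne_zero hj)) hz
  have h2 : ‖(2 : ℚ_[p])‖ ≤ 1 := (HasResidue.ofNat 2).norm_le_one
  have h4 : ‖(4 : ℚ_[p])‖ ≤ 1 := (HasResidue.ofNat 4).norm_le_one
  convert (((PadicCongr.refl 2 (2 / (2 * j + 1 : ℚ_[p]))).add (inv_odd.mul_left h4)).add
    ((inv_even (z := -1) (by simp)).mul_left h2)).sub
    ((inv_even norm_one.le).mul_left h2) using 1
  · ring
  · rw [show (2 * j + 2 : ℚ_[p]) = 2 * (j + 1) by ring]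
    field

theorem padicCongr_dixonTermLogDeriv {k n : ℕ} (h : p = 2 * n + 1) (hk : k ≤ n) :
    PadicCongr p 2 (dixonTermLogDeriv (p : ℚ_[p]) k)
      (6 * oddSum ℚ_[p] 1 k + p * (harmonicSq ℚ_[p] k - 4 * oddSum ℚ_[p] 2 k)) := by
  simp only [oddSum, harmonicSq, dixonTermLogDeriv, mul_sum, ← sum_sub_distrib, ← sum_add_distrib]
  exact .sum fun j hj => padicCongr_two_div_add_four_div (by grind)

theorem padicCongr_sum_mul_dixonSumLogDeriv {n : ℕ} (h : p = 2 * n + 1) :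
    PadicCongr p 2
      ((∑ k ∈ range (n + 1), whippleTerm ((p : ℚ_[p]) ^ 2) n k) * dixonSumLogDeriv ℚ_[p] n)
      (6 * cubeSum (oddSum ℚ_[p] 1) n +
        p * (cubeSum (harmonicSq ℚ_[p]) n - 4 * cubeSum (oddSum ℚ_[p] 2) n)) := by
  have hn : (2 * n + 1 : ℚ_[p]) = p := by exact_mod_cast h.symm
  have dixon := sum_whippleTerm_mul_logDeriv ℚ_[p] n
  rw [hn] at dixon
  have expansion : 6 * cubeSum (oddSum ℚ_[p] 1) n +
      p * (cubeSum (harmonicSq ℚ_[p]) n - 4 * cubeSum (oddSum ℚ_[p] 2) n) =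
      ∑ k ∈ range (n + 1), centralRatio ℚ_[p] k ^ 3 *
        (6 * oddSum ℚ_[p] 1 k + p * (harmonicSq ℚ_[p] k - 4 * oddSum ℚ_[p] 2 k)) := by
    simp only [cubeSum, mul_sum, ← sum_sub_distrib, ← sum_add_distrib]
    exact sum_congr rfl fun k _ => by ring
  rw [← dixon, expansion]
  refine .sum fun k hk => ?_
  have hk : k ≤ n := by grind
  have integral := ((HasResidue.ofNat 6).mul (hasResidue_oddSum (p := p) 1 (k := k) (by omega))).add
    (HasResidue.prime.mul ((hasResidue_harmonicSq (k := k) (by omega)).sub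
      ((HasResidue.ofNat 4).mul (hasResidue_oddSum 2 (k := k) (by omega)))))
  exact (padicCongr_whippleTerm h hk).mul (padicCongr_dixonTermLogDeriv h hk)
    (hasResidue_whippleTerm h hasResidue_prime_sq hk).norm_le_one integral.norm_le_one

theorem hasResidue_six_mul_cubeSum_oddSum_div {n : ℕ} (h : p = 2 * n + 1) {y : ZMod p}
    (hy : HasResidue ((∑ k ∈ range (n + 1), whippleTerm ((p : ℚ_[p]) ^ 2) n k) *
      dixonSumLogDeriv ℚ_[p] n / (p : ℚ_[p])) y) :
    HasResidue (6 * cubeSum (oddSum ℚ_[p] 1) n / (p : ℚ_[p]))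
      (y - (cubeSum (harmonicSq (ZMod p)) n - 4 * cubeSum (oddSum (ZMod p) 2) n)) := by
  have correction := (hasResidue_cubeSum (p := p) (n := n) (by omega) fun k hk =>
    hasResidue_harmonicSq (k := k) (by omega)).sub ((HasResidue.ofNat 4).mul
    (hasResidue_cubeSum (n := n) (by omega) fun k hk => hasResidue_oddSum 2 (k := k) (by omega)))
  convert (hy.of_padicCongr (padicCongr_sum_mul_dixonSumLogDeriv h).symm.div_prime).sub
    correction using 1
  field [NeZero.ne (p : ℚ_[p])]

end DixonSumModPrimeSq

section CubeSumValues

open Finset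

variable {p : ℕ} [Fact p.Prime] {m : ℕ}

theorem six_zmod_ne_zero (hp : 3 < p) : (6 : ZMod p) ≠ 0 := by
  rw [show (6 : ZMod p) = 2 * 3 by norm_num]
  exact mul_ne_zero (ofNat_zmod_ne_zero (by omega)) (ofNat_zmod_ne_zero hp)

theorem hasResidue_cubeSum_oddSum_one_div_even (h : p = 2 * (2 * m) + 1) (hp : 3 < p) :
    HasResidue (cubeSum (oddSum ℚ_[p] 1) (2 * m) / (p : ℚ_[p])) 0 := by
  have six :=
    hasResidue_six_mul_cubeSum_oddSum_div h (hasResidue_sum_mul_dixonSumLogDeriv_even h hp)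
  have reflect := four_mul_cubeSum_oddSum_two_zmod h hp
  rw [Even.neg_one_pow ⟨m, two_mul m⟩] at reflect
  convert six.div (.ofNat 6) (six_zmod_ne_zero hp) using 1
  · ring
  · rw [← two_mul_cubeSum_harmonicSq_zmod_even h hp, reflect]
    ring

theorem hasResidue_cubeSum_oddSum_one_div_odd (h : p = 2 * (2 * m + 1) + 1) (hp : 3 < p) :
    HasResidue (cubeSum (oddSum ℚ_[p] 1) (2 * m + 1) / (p : ℚ_[p])) (-(m.factorial ^ 4 / 12)) := by
  have six := hasResidue_six_mul_cubeSum_oddSum_div h (hasResidue_sum_mul_dixonSumLogDeriv_odd h)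
  have reflect := four_mul_cubeSum_oddSum_two_zmod h hp
  rw [Odd.neg_one_pow ⟨m, rfl⟩] at reflect
  convert six.div (.ofNat 6) (six_zmod_ne_zero hp) using 1
  · ring
  · rw [reflect, neg_neg, one_mul, sub_self, sub_zero, div_div, neg_div]
    norm_num

theorem eight_mul_cubeSum_oddSum_two_zmod_even (h : p = 2 * (2 * m) + 1) (hp : 3 < p) :
    8 * cubeSum (oddSum (ZMod p) 2) (2 * m) =
      -(centralRatio (ZMod p) m ^ 2 * harmonicSq (ZMod p) m) := by
  have reflect := four_mul_cubeSum_oddSum_two_zmod h hp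
  rw [Even.neg_one_pow ⟨m, two_mul m⟩] at reflect
  linear_combination 2 * reflect - two_mul_cubeSum_harmonicSq_zmod_even h hp

theorem sixteen_mul_cubeSum_oddSum_two_zmod_odd (h : p = 2 * (2 * m + 1) + 1) (hp : 3 < p) :
    16 * cubeSum (oddSum (ZMod p) 2) (2 * m + 1) = -(m.factorial : ZMod p) ^ 4 := by
  have reflect := four_mul_cubeSum_oddSum_two_zmod h hp
  rw [Odd.neg_one_pow ⟨m, rfl⟩] at reflect
  linear_combination 4 * reflect + four_mul_cubeSum_harmonicSq_zmod_odd h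

end CubeSumValues

section Truncation

open Finset

variable {K : Type*} [Field K] [CharZero K]

theorem centralRatio_eq_choose (k : ℕ) : centralRatio K k = (2 * k).choose k / 4 ^ k := by
  rw [← Nat.centralBinom_eq_two_mul_choose]
  induction k with
  | zero => simp [centralRatio]
  | succ k ih =>
    have recurrence := congrArg (Nat.cast (R := K)) (Nat.succ_mul_centralBinom_succ k)
    push_cast at recurrence
    have hk : (k + 1 : K) ≠ 0 := Nat.cast_add_one_ne_zero k
    rw [centralRatio_succ, ih, pow_succ, show (2 * k + 2 : K) = 2 * (k + 1) by ring]
    field_simp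
    linear_combination -2 * recurrence

theorem ratCast_oddHarmonic (r k : ℕ) : (oddHarmonic r k : K) = oddSum K r k := by
  rw [oddHarmonic, oddSum, Rat.cast_sum, ← Ico_add_one_right_eq_Icc, ← sum_Ico_add' _ 0 k 1,
    ← range_eq_Ico]
  refine sum_congr rfl fun j _ => ?_
  push_cast
  ring

theorem ratCast_truncatedSum (p r : ℕ) :
    (truncatedSum p r : K) = cubeSum (oddSum K r) (p - 1) := by
  rw [truncatedSum, cubeSum, sum_range_succ', show oddSum K r 0 = 0 from sum_range_zero _,
    mul_zero, add_zero, Rat.cast_sum, range_eq_Ico,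
    sum_Ico_add' (fun k => centralRatio K k ^ 3 * oddSum K r k) 0 (p - 1) 1, zero_add,
    Ico_add_one_right_eq_Icc]
  refine sum_congr rfl fun k _ => ?_
  push_cast
  rw [ratCast_oddHarmonic, centralRatio_eq_choose, div_pow, pow_right_comm, mul_div_right_comm]
  norm_num

variable {p : ℕ} [Fact p.Prime]

theorem norm_natCast_eq_one_of_not_dvd {k : ℕ} (hk : ¬p ∣ k) : ‖(k : ℚ_[p])‖ = 1 :=
  (HasResidue.natCast k).norm_eq_one (mt (ZMod.natCast_eq_zero_iff k p).1 hk)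

theorem norm_prime_div_natCast_le_one {k : ℕ} (hk : ¬p ^ 2 ∣ k) : ‖(p / k : ℚ_[p])‖ ≤ 1 := by
  by_cases hpk : p ∣ k
  · obtain ⟨c, rfl⟩ := hpk
    rw [pow_two, Nat.mul_dvd_mul_iff_left (Fact.out : p.Prime).pos] at hk
    rw [Nat.cast_mul, div_mul_cancel_left₀ (NeZero.ne (p : ℚ_[p])), norm_inv,
      norm_natCast_eq_one_of_not_dvd hk, inv_one]
  · rw [norm_div, norm_natCast_eq_one_of_not_dvd hpk, div_one]
    exact HasResidue.prime.norm_le_one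

theorem norm_centralRatio_div_prime_le_one (hp : 2 < p) {k : ℕ} (hk : k < p) (hpk : p ≤ 2 * k) :
    ‖centralRatio ℚ_[p] k / p‖ ≤ 1 := by
  obtain ⟨c, hc⟩ := Nat.Prime.dvd_choose_add Fact.out hk hk (two_mul k ▸ hpk)
  have four : HasResidue (4 : ℚ_[p]) 4 := .ofNat 4
  have h4 : (4 : ZMod p) ≠ 0 := by
    rw [show (4 : ZMod p) = 2 ^ 2 by norm_num]
    exact pow_ne_zero 2 (ofNat_zmod_ne_zero hp)
  rw [centralRatio_eq_choose, two_mul, hc, Nat.cast_mul, div_right_comm,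
    mul_div_cancel_left₀ _ (NeZero.ne (p : ℚ_[p]))]
  exact ((HasResidue.natCast c).div (four.pow k) (pow_ne_zero k h4)).norm_le_one

theorem norm_prime_pow_mul_oddSum_le_one (r : ℕ) {k : ℕ} (hk : 2 * k ≤ p ^ 2) :
    ‖(p : ℚ_[p]) ^ r * oddSum ℚ_[p] r k‖ ≤ 1 := by
  rw [oddSum, mul_sum]
  refine IsUltrametricDist.norm_sum_le_of_forall_le_of_nonneg zero_le_one fun j hj => ?_
  have integral := norm_prime_div_natCast_le_one (p := p) (k := 2 * j + 1)
    (Nat.not_dvd_of_pos_of_lt (2 * j).succ_pos (by grind))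
  push_cast at integral
  rw [mul_one_div, ← div_pow, norm_pow]
  exact pow_le_one₀ (norm_nonneg _) integral

theorem padicCongr_cubeTerm_zero (hp : 2 < p) {r : ℕ} (hr : r ≤ 3) {k : ℕ} (hk : k < p)
    (hpk : p ≤ 2 * k) :
    PadicCongr p (3 - r) (centralRatio ℚ_[p] k ^ 3 * oddSum ℚ_[p] r k) 0 := by
  have ratio := norm_centralRatio_div_prime_le_one hp hk hpk
  have odd := norm_prime_pow_mul_oddSum_le_one (p := p) r (k := k) (by nlinarith)
  have integral : ‖(centralRatio ℚ_[p] k / p) ^ 3 * ((p : ℚ_[p]) ^ r * oddSum ℚ_[p] r k)‖ ≤ 1 := by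
    rw [norm_mul, norm_pow]
    exact mul_le_one₀ (pow_le_one₀ (norm_nonneg _) ratio) (norm_nonneg _) odd
  have hp0 := NeZero.ne (p : ℚ_[p])
  refine ⟨⟨_, integral⟩, ?_⟩
  change _ = (p : ℚ_[p]) ^ (3 - r) *
    ((centralRatio ℚ_[p] k / p) ^ 3 * ((p : ℚ_[p]) ^ r * oddSum ℚ_[p] r k))
  rw [sub_zero, mul_left_comm, ← mul_assoc ((p : ℚ_[p]) ^ (3 - r)), pow_sub_mul_pow _ hr]
  field_simp

theorem padicCongr_truncatedSum_cubeSum {n : ℕ} (h : p = 2 * n + 1) {r : ℕ} (hr : r ≤ 3) :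
    PadicCongr p (3 - r) (truncatedSum p r : ℚ_[p]) (cubeSum (oddSum ℚ_[p] r) n) := by
  have hp : 2 < p := by
    have := (Fact.out : p.Prime).two_le
    omega
  rw [ratCast_truncatedSum, cubeSum, show p - 1 + 1 = n + 1 + n by omega, sum_range_add, ← cubeSum]
  have tail := PadicCongr.sum (s := range n) fun i hi =>
    padicCongr_cubeTerm_zero (p := p) hp hr (k := n + 1 + i) (by grind) (by omega)
  simpa only [sum_const_zero, add_zero] using (PadicCongr.refl _ _).add tail

end Truncation

section EulerNumbers

open Finset

theorem sum_choose_mul_eulerNumber (m : ℕ) :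
    ∑ j ∈ range (m + 1), (if Even (m - j) then (m.choose j : ℚ) else 0) * eulerNumber j =
      0 ^ m := by
  have unit_constantCoeff : PowerSeries.constantCoeff coshSeries ≠ 0 := by
    simp [coshSeries, ← PowerSeries.coeff_zero_eq_constantCoeff_apply]
  have coeff_inv_mul := congrArg (fun f => (m.factorial : ℚ) * PowerSeries.coeff m f)
    (PowerSeries.inv_mul_cancel coshSeries unit_constantCoeff)
  simp only [PowerSeries.coeff_mul, PowerSeries.coeff_one] at coeff_inv_mul
  rw [Nat.sum_antidiagonal_eq_sum_range_succ
      (fun i j => PowerSeries.coeff i coshSeries⁻¹ * PowerSeries.coeff j coshSeries),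
    mul_sum] at coeff_inv_mul
  trans (m.factorial : ℚ) * (if m = 0 then 1 else 0)
  · rw [← coeff_inv_mul]
    refine sum_congr rfl fun j hj => ?_
    rw [coshSeries, PowerSeries.coeff_mk, eulerNumber, ← coshSeries]
    split_ifs
    · rw [Nat.cast_choose ℚ (mem_range_succ_iff.1 hj)]
      field
    · simp
  · rcases eq_or_ne m 0 with rfl | hm <;> simp [*]

theorem add_one_pow_add_sub_one_pow {R : Type*} [CommRing R] (x : R) (m : ℕ) :
    (x + 1) ^ m + (x - 1) ^ m =
      2 * ∑ j ∈ range (m + 1), (if Even (m - j) then (m.choose j : R) else 0) * x ^ j := by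
  rw [sub_eq_add_neg, add_pow, add_pow, ← sum_add_distrib, mul_sum]
  refine sum_congr rfl fun j _ => ?_
  split_ifs with parity
  · rw [parity.neg_one_pow, one_pow]
    ring
  · rw [(Nat.not_even_iff_odd.1 parity).neg_one_pow, one_pow]
    ring

theorem sum_range_neg_one_pow_mul_add {R : Type*} [CommRing R] (g : ℕ → R) (N : ℕ) :
    ∑ t ∈ range N, (-1) ^ t * (g (t + 1) + g t) = g 0 - (-1) ^ N * g N := by
  induction N with
  | zero => simp
  | succ N ih =>
    rw [sum_range_succ, ih]
    ring

theorem two_mul_sum_neg_one_pow_div_sq {K : Type*} [Field K] (h2 : (2 : K) ≠ 0) (m : ℕ) :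
    2 * ∑ i ∈ range (2 * m), (-1) ^ (i + 1) * (1 / (i + 1 : K) ^ 2) =
      harmonicSq K m - 2 * harmonicSq K (2 * m) := by
  induction m with
  | zero => simp [harmonicSq]
  | succ m ih =>
    have sign : (-1 : K) ^ (2 * m + 1) = -1 := Odd.neg_one_pow ⟨m, rfl⟩
    rw [harmonicSq, harmonicSq, mul_add, sum_range_succ, sum_range_succ, sum_range_succ,
      sum_range_succ, sum_range_succ, ← harmonicSq, ← harmonicSq, pow_succ _ (2 * m + 1), sign]
    push_cast
    linear_combination ih + four_mul_one_div_two_mul_add_two_sq h2 m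

variable {p : ℕ} [Fact p.Prime]

variable (p) in
/-- The alternating sum of the `m`-th powers of the first `p` odd numbers modulo `p`, which turns
out to be the residue of the Euler number `E_m`. -/
def alternatingPowerSum (m : ℕ) : ZMod p :=
  ∑ t ∈ range p, (-1) ^ t * (2 * t + 1 : ZMod p) ^ m

theorem sum_choose_mul_alternatingPowerSum (hp : 2 < p) (m : ℕ) :
    ∑ j ∈ range (m + 1), (if Even (m - j) then (m.choose j : ZMod p) else 0) *
      alternatingPowerSum p j = 0 ^ m := by
  have h2 : (2 : ZMod p) ≠ 0 := ofNat_zmod_ne_zero hp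
  have odd : Odd p := (Fact.out : p.Prime).odd_of_ne_two hp.ne'
  have telescope := sum_range_neg_one_pow_mul_add (fun t => (2 * t : ZMod p) ^ m) p
  rw [odd.neg_one_pow, ZMod.natCast_self, Nat.cast_zero, mul_zero] at telescope
  apply mul_left_cancel₀ h2
  trans (0 ^ m - -1 * 0 ^ m : ZMod p)
  · simp only [← telescope, alternatingPowerSum, mul_sum]
    rw [sum_comm]
    refine sum_congr rfl fun t _ => ?_
    have binomial := add_one_pow_add_sub_one_pow (2 * t + 1 : ZMod p) m
    rw [show (2 * t + 1 + 1 : ZMod p) = 2 * (t + 1 : ℕ) by push_cast; ring, add_sub_cancel_right]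
      at binomial
    rw [binomial, mul_sum, mul_sum]
    exact sum_congr rfl fun j _ => by ring
  · ring

theorem hasResidue_eulerNumber (hp : 2 < p) (m : ℕ) :
    HasResidue (eulerNumber m : ℚ_[p]) (alternatingPowerSum p m) := by
  induction m using Nat.strong_induction_on with
  | _ m ih =>
    have euler := congrArg (Rat.cast (K := ℚ_[p])) (sum_choose_mul_eulerNumber m)
    have power := sum_choose_mul_alternatingPowerSum hp m
    rw [sum_range_succ, Nat.sub_self, if_pos Even.zero, Nat.choose_self, Nat.cast_one, one_mul,
      ← eq_sub_iff_add_eq'] at power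
    rw [sum_range_succ, Nat.sub_self, if_pos Even.zero, Nat.choose_self, Nat.cast_one, one_mul,
      Rat.cast_add, ← eq_sub_iff_add_eq'] at euler
    push_cast at euler
    rw [euler, power]
    refine (HasResidue.zero.pow m).sub (.sum fun j hj => .mul ?_ (ih j (mem_range.1 hj)))
    split_ifs
    exacts [.natCast _, .zero]

theorem four_mul_alternatingPowerSum {m : ℕ} (h : p = 2 * (2 * m) + 1) (hp : 3 < p) :
    4 * alternatingPowerSum p (p - 3) = harmonicSq (ZMod p) m := by
  have h2 : (2 : ZMod p) ≠ 0 := ofNat_zmod_ne_zero (by omega)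
  have center := two_mul_half_zmod h
  push_cast at center
  have half := two_mul_sum_neg_one_pow_div_sq h2 m
  rw [harmonicSq_half_zmod h hp, mul_zero, sub_zero] at half
  have fold := sum_range_two_mul_add_one (m := 2 * m)
    (f := fun t => 4 * ((-1) ^ t * (2 * t + 1 : ZMod p) ^ (p - 3)))
    (g := fun i => 2 * ((-1) ^ (i + 1) * (1 / (i + 1 : ZMod p) ^ 2))) fun i j hij => by
      have right : (2 * (2 * m + 1 + i : ℕ) + 1 : ZMod p) = 2 * i + 2 := by
        push_cast
        linear_combination center
      have left : (2 * j + 1 : ZMod p) = -(2 * i + 2) := by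
        have cast_hij := congrArg (Nat.cast (R := ZMod p)) hij
        push_cast at cast_hij
        linear_combination 2 * cast_hij + center
      have sign_right : (-1 : ZMod p) ^ (2 * m + 1 + i) = (-1) ^ (i + 1) :=
        neg_one_pow_congr (by grind)
      have sign_left : (-1 : ZMod p) ^ j = (-1) ^ (i + 1) := neg_one_pow_congr (by grind)
      simp only [zmod_pow_sub_three hp, right, left, sign_right, sign_left, neg_sq]
      linear_combination 2 * (-1) ^ (i + 1) * four_mul_one_div_two_mul_add_two_sq h2 i
  have middle : (2 * (2 * m : ℕ) + 1 : ZMod p) ^ (p - 3) = 0 := by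
    rw [two_mul_half_zmod h, neg_add_cancel, zero_pow (by omega)]
  rw [← mul_sum, ← mul_sum, ← h, half, middle, mul_zero, mul_zero, zero_add] at fold
  exact fold

end EulerNumbers

section GammaAtOneQuarter

open Finset

variable {p : ℕ} [Fact p.Prime]

theorem gammaSeq_add_one {k : ℕ} (hk : k < p) :
    gammaSeq p (k + 1) = (-1) ^ (k + 1) * k.factorial := by
  have prime : p.Prime := Fact.out
  induction k with
  | zero =>
    rw [gammaSeq_succ]
    simp [gammaSeq, Nat.coprime_zero_left, prime.ne_one]
  | succ k ih =>
    have coprime : (k + 1).Coprime p :=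
      (Nat.coprime_of_lt_prime k.succ_ne_zero hk prime).symm
    rw [gammaSeq_succ, ih (by omega), if_pos coprime, Nat.factorial_succ]
    push_cast
    ring

theorem gammaSeq_add_one_pow_four_zmod {k : ℕ} (hk : k < p) :
    ((gammaSeq p (k + 1) : ℤ) : ZMod p) ^ 4 = (k.factorial : ZMod p) ^ 4 := by
  rw [gammaSeq_add_one hk]
  push_cast
  rw [mul_pow, pow_right_comm, Even.neg_one_pow ⟨2, rfl⟩, one_pow, one_mul]

theorem hasResidue_padicGamma (hp : p ≠ 2) {x : ℤ_[p]} {N : ℕ} (h : (p : ℤ_[p]) ∣ x - N) :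
    HasResidue (padicGamma p x : ℚ_[p]) ((gammaSeq p N : ℤ) : ZMod p) := by
  have approximation := norm_padicGamma_sub_le p hp 1 N one_ne_zero x (by
    rwa [PadicInt.norm_le_pow_iff_mem_span_pow, pow_one, Ideal.mem_span_singleton])
  rw [PadicInt.norm_le_pow_iff_mem_span_pow, Ideal.mem_span_singleton] at approximation
  obtain ⟨z, hz⟩ := approximation
  exact (HasResidue.intCast (gammaSeq p N)).of_padicCongr ⟨z, by exact_mod_cast congrArg _ hz⟩

theorem prime_dvd_inv_four_sub (hp : p ≠ 2) {N c : ℕ} (h : 4 * N = p * c + 1) :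
    (p : ℤ_[p]) ∣ (PadicInt.inv 4 : ℤ_[p]) - N := by
  have h' : (4 * N : ℤ_[p]) = p * c + 1 := by exact_mod_cast h
  refine ⟨-(c * (PadicInt.inv 4 : ℤ_[p])), ?_⟩
  linear_combination (N : ℤ_[p]) * four_mul_inv_four p hp - (PadicInt.inv 4 : ℤ_[p]) * h'

theorem hasResidue_padicGamma_inv_four_pow_four (hp : p ≠ 2) {k c : ℕ} (hk : k < p)
    (h : 4 * (k + 1) = p * c + 1) :
    HasResidue ((padicGamma p (PadicInt.inv 4) : ℚ_[p]) ^ 4) ((k.factorial : ZMod p) ^ 4) := by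
  rw [← gammaSeq_add_one_pow_four_zmod hk]
  exact (hasResidue_padicGamma hp (prime_dvd_inv_four_sub hp h)).pow 4

variable {m : ℕ}

theorem factorial_three_mul_pow_four_zmod (h : p = 2 * (2 * m) + 1) :
    ((3 * m).factorial : ZMod p) ^ 4 = -centralRatio (ZMod p) m ^ 2 := by
  have reflection := factorial_mul_factorial_zmod (p := p) (a := 3 * m) (b := m) (by omega)
  have wilson := factorial_mul_factorial_zmod (p := p) (a := 2 * m) (b := 2 * m) (by omega)
  rw [Odd.neg_one_pow ⟨m, rfl⟩] at wilson
  have binomial := congrArg (Nat.cast (R := ZMod p))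
    (Nat.choose_mul_factorial_mul_factorial (show m ≤ 2 * m by omega))
  rw [show 2 * m - m = m by omega] at binomial
  push_cast at binomial
  have product : ((3 * m).factorial : ZMod p) ^ 4 * (m.factorial : ZMod p) ^ 4 = 1 := by
    rw [← mul_pow, reflection, pow_right_comm, Even.neg_one_pow ⟨2, rfl⟩, one_pow]
  have binomial_sq : ((2 * m).choose m : ZMod p) ^ 2 * (m.factorial : ZMod p) ^ 4 = -1 := by
    rw [← wilson, ← binomial]
    ring
  rw [centralRatio_zmod h (by omega), mul_pow, pow_right_comm, neg_one_sq, one_pow, one_mul]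
  linear_combination ((3 * m).factorial : ZMod p) ^ 4 * binomial_sq
    - ((2 * m).choose m : ZMod p) ^ 2 * product

theorem hasResidue_padicGamma_inv_four_pow_four_even (h : p = 2 * (2 * m) + 1) :
    HasResidue ((padicGamma p (PadicInt.inv 4) : ℚ_[p]) ^ 4) (-centralRatio (ZMod p) m ^ 2) := by
  rw [← factorial_three_mul_pow_four_zmod h]
  exact hasResidue_padicGamma_inv_four_pow_four (c := 3) (by omega) (by omega) (by omega)

theorem hasResidue_padicGamma_inv_four_pow_four_odd (h : p = 2 * (2 * m + 1) + 1) :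
    HasResidue ((padicGamma p (PadicInt.inv 4) : ℚ_[p]) ^ 4) ((m.factorial : ZMod p) ^ 4) :=
  hasResidue_padicGamma_inv_four_pow_four (c := 1) (by omega) (by omega) (by omega)

end GammaAtOneQuarter

section TruncatedSums

variable {p : ℕ} [Fact p.Prime]

theorem padicCongr_truncatedSum_one_of_mod_four_eq_one (hp : 3 < p) (hp4 : p % 4 = 1) :
    PadicCongr p 2 (truncatedSum p 1 : ℚ_[p]) 0 := by
  obtain ⟨m, h⟩ : ∃ m, p = 2 * (2 * m) + 1 := ⟨p / 4, by omega⟩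
  rw [← mul_zero (p : ℚ_[p])]
  exact (padicCongr_truncatedSum_cubeSum h (by norm_num : 1 ≤ 3)).trans
    ((hasResidue_cubeSum_oddSum_one_div_even h hp).padicCongr_prime_mul .zero)

theorem padicCongr_truncatedSum_one_of_mod_four_eq_three (hp : 3 < p) (hp4 : p % 4 = 3) :
    PadicCongr p 2 (truncatedSum p 1 : ℚ_[p])
      (-((p : ℚ_[p]) / 12) * (padicGamma p (PadicInt.inv 4) : ℚ_[p]) ^ 4) := by
  obtain ⟨m, h⟩ : ∃ m, p = 2 * (2 * m + 1) + 1 := ⟨p / 4, by omega⟩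
  have twelve : (12 : ZMod p) ≠ 0 := by
    rw [show (12 : ZMod p) = 2 * 6 by norm_num]
    exact mul_ne_zero (ofNat_zmod_ne_zero (by omega)) (six_zmod_ne_zero hp)
  have gamma := ((hasResidue_padicGamma_inv_four_pow_four_odd h).div (.ofNat 12) twelve).neg
  convert (padicCongr_truncatedSum_cubeSum h (by norm_num : 1 ≤ 3)).trans
    ((hasResidue_cubeSum_oddSum_one_div_odd h hp).padicCongr_prime_mul gamma) using 1
  ring

theorem padicCongr_truncatedSum_two_of_mod_four_eq_one (hp : 3 < p) (hp4 : p % 4 = 1) :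
    PadicCongr p 1 (truncatedSum p 2 : ℚ_[p])
      (1 / 2 * (padicGamma p (PadicInt.inv 4) : ℚ_[p]) ^ 4 * (eulerNumber (p - 3) : ℚ_[p])) := by
  obtain ⟨m, h⟩ : ∃ m, p = 2 * (2 * m) + 1 := ⟨p / 4, by omega⟩
  have h2 : (2 : ZMod p) ≠ 0 := ofNat_zmod_ne_zero (by omega)
  have value : cubeSum (oddSum (ZMod p) 2) (2 * m) =
      1 / 2 * -centralRatio (ZMod p) m ^ 2 * alternatingPowerSum p (p - 3) := by
    rw [one_div_mul_eq_div, div_mul_eq_mul_div, eq_div_iff h2]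
    apply mul_left_cancel₀ (pow_ne_zero 2 h2)
    linear_combination eight_mul_cubeSum_oddSum_two_zmod_even h hp
      + centralRatio (ZMod p) m ^ 2 * four_mul_alternatingPowerSum h hp
  have sum := hasResidue_cubeSum (n := 2 * m) (by omega) fun k hk =>
    hasResidue_oddSum (p := p) 2 (k := k) (by omega)
  rw [value] at sum
  exact (padicCongr_truncatedSum_cubeSum h (by norm_num : 2 ≤ 3)).trans <| sum.padicCongr <|
    ((HasResidue.one.div (.ofNat 2) h2).mul (hasResidue_padicGamma_inv_four_pow_four_even h)).mul
      (hasResidue_eulerNumber (by omega) (p - 3))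

theorem padicCongr_truncatedSum_two_of_mod_four_eq_three (hp : 3 < p) (hp4 : p % 4 = 3) :
    PadicCongr p 1 (truncatedSum p 2 : ℚ_[p])
      (-(1 / 16) * (padicGamma p (PadicInt.inv 4) : ℚ_[p]) ^ 4) := by
  obtain ⟨m, h⟩ : ∃ m, p = 2 * (2 * m + 1) + 1 := ⟨p / 4, by omega⟩
  have sixteen : (16 : ZMod p) ≠ 0 := by
    rw [show (16 : ZMod p) = 2 ^ 4 by norm_num]
    exact pow_ne_zero 4 (ofNat_zmod_ne_zero (by omega))
  have value : cubeSum (oddSum (ZMod p) 2) (2 * m + 1) =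
      -(1 / 16) * (m.factorial : ZMod p) ^ 4 := by
    rw [neg_mul, one_div_mul_eq_div, ← neg_div, eq_div_iff sixteen, mul_comm,
      sixteen_mul_cubeSum_oddSum_two_zmod_odd h hp]
  have sum := hasResidue_cubeSum (n := 2 * m + 1) (by omega) fun k hk =>
    hasResidue_oddSum (p := p) 2 (k := k) (by omega)
  rw [value] at sum
  exact (padicCongr_truncatedSum_cubeSum h (by norm_num : 2 ≤ 3)).trans <| sum.padicCongr <|
    (HasResidue.one.div (.ofNat 16) sixteen).neg.mul
      (hasResidue_padicGamma_inv_four_pow_four_odd h)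

end TruncatedSums

theorem mainTheorem3 (p : ℕ) [Fact p.Prime] (hp : 3 < p) :
    (p % 4 = 1 →
      PadicCongr p 2 (truncatedSum p 1 : ℚ_[p]) 0) ∧
    (p % 4 = 3 →
      PadicCongr p 2 (truncatedSum p 1 : ℚ_[p])
        (-((p : ℚ_[p]) / 12) * (padicGamma p (PadicInt.inv 4) : ℚ_[p]) ^ 4)) ∧
    (p % 4 = 1 →
      PadicCongr p 1 (truncatedSum p 2 : ℚ_[p])
        (1 / 2 * (padicGamma p (PadicInt.inv 4) : ℚ_[p]) ^ 4 * (eulerNumber (p - 3) : ℚ_[p]))) ∧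
    (p % 4 = 3 →
      PadicCongr p 1 (truncatedSum p 2 : ℚ_[p])
        (-(1 / 16) * (padicGamma p (PadicInt.inv 4) : ℚ_[p]) ^ 4)) :=
  ⟨padicCongr_truncatedSum_one_of_mod_four_eq_one hp,
    padicCongr_truncatedSum_one_of_mod_four_eq_three hp,
    padicCongr_truncatedSum_two_of_mod_four_eq_one hp,
    padicCongr_truncatedSum_two_of_mod_four_eq_three hp⟩
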